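/- Let $\Phi$ be an irreducible reduced (crystallographic) root system in a finite-dimensional real vector space $V$ with Weyl group $W$, let $\Delta$ be a fundamental system with positive roots $\Phi^+$, put $\Phi^-=-\Phi^+$, and fix $\alpha_p\in\Delta$. Let $\lambda_p$ be the fundamental weight of $\alpha_p$ (so $\langle\lambda_p,\alpha^\vee\rangle=1$ for $\alpha=\alpha_p$ and $=0$ for $\alpha\in\Delta_p:=\Delta\setminus\{\alpha_p\}$), $\rho=\frac12\sum_{\alpha\in\Phi^+}\alpha$, $\mathrm{ht}\,\alpha^\vee=\langle\rho,\alpha^\vee\rangle$, $\Phi_p^+=\{\alpha\in\Phi^+:\langle\lambda_p,\alpha^\vee\rangle=0\}$, and $$\mathfrak W_p=\{w\in W:\Delta_p\subset w^{-1}(\Delta\cup\Phi^-)\}.$$ For a root $\alpha$ and $w\in W$ let $\delta_{\alpha,w}=1$ if $w\alpha\in\Phi^+$ and $\delta_{\alpha,w}=0$ if $w\alpha\in\Phi^-$, and write $\ell_\alpha(s)=\langle\lambda_p,\alpha^\vee\rangle s+\mathrm{ht}\,\alpha^\vee$. Let $\xi(s)=s(s-1)\pi^{-s/2}\Gamma(s/2)\zeta(s)$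 (an entire function). For $w\in\mathfrak W_p$ define the entire function $$X_{p,w}(s)=\prod_{\alpha\in\Phi^+\setminus\Phi_p^+}\xi(\ell_\alpha(s)+\delta_{\alpha,w}),$$ the constant $$C_{p,w}=\xi(2)^{|\Delta_p\cap w^{-1}\Phi^+|}\prod_{\alpha\in\Phi_p^+\setminus\Delta_p}\xi(\mathrm{ht}\,\alpha^\vee+\delta_{\alpha,w}),$$ the polynomial $$Q_{p,w}(s)=C_{p,w}\prod_{v\in\mathfrak W_p,\,v\ne w}\Bigl[2^{|\Delta_p\cap v^{-1}\Phi^+|}\prod_{\alpha\in v^{-1}\Delta\setminus\Delta_p}(\ell_\alpha(s)-1)\prod_{\alpha\in\Phi^+\setminus\Delta_p}(\ell_\alpha(s)+\delta_{\alpha,v})(\ell_\alpha(s)+\delta_{\alpha,v}-1)\Bigr],$$ and $l_p(w)=|(\Phi^+\setminus\Phi_p^+)\cap w^{-1}\Phi^-|$. With $n=|\Phi^+\setminus\Phi_p^+|$ put $$E_p(s)=\sum_{w\in\mathfrak W_p,\;l_p(w)<n/2}Q_{p,w}(s)X_{p,w}(s)+\frac12\sum_{w\in\mathfrak W_p,\;l_p(w)=n/2}Q_{p,w}(s)X_{p,w}(s).$$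 For integers $k,h$ let $N_p(k,h)=|\{\alpha\in\Phi:\langle\lambda_p,\alpha^\vee\rangle=k,\ \mathrm{ht}\,\alpha^\vee=h\}|$, let $N_{p,w}(k,h)$ be the number of those $\alpha$ which also lie in $w^{-1}\Phi^-$, and let $M_p(k,h)=\max_{w\in\mathfrak W_p}(N_{p,w}(k,h-1)-N_{p,w}(k,h))$. Put $$D_p(s)=\prod_{k\ge1}\prod_{h\ge2}\xi(ks+h)^{N_p(k,h-1)-M_p(k,h)}$$ (a finite product), let $R_p(s)$ be the monic greatest common divisor in $\mathbb C[s]$ of the polynomials $Q_{p,w}$, $w\in\mathfrak W_p$, and put $\varepsilon_p(s)=E_p(s)/(R_p(s)D_p(s))$. Then there exists a real number $\kappa>0$ such that neither $E_p(s)$ nor $\varepsilon_p(s)$ has a zero in the region $\operatorname{Re}(s)\le-\kappa\log(|\operatorname{Im}(s)|+10)$ (and the denominator $R_p(s)D_p(s)$ does not vanish there). -/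

import Mathlib

namespace WengZeta

noncomputable section

open Polynomial
open scoped Classical

/-- The entire function `ξ(s) = s (s - 1) π^{-s/2} Γ(s/2) ζ(s)`.  Mathlib's entire function
`completedRiemannZeta₀` is `π^{-s/2} Γ(s/2) ζ(s) + 1/s + 1/(1-s)`, so the formula below has no
junk values; see `xi_eq` and `xi_eq_of_re_pos`. -/
def xi (s : ℂ) : ℂ :=
  s * (s - 1) * completedRiemannZeta₀ s + 1

theorem xi_eq (s : ℂ) (h0 : s ≠ 0) (h1 : s ≠ 1) :
    xi s = s * (s - 1) * completedRiemannZeta s := by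
  have h2 : (1 - s) ≠ 0 := sub_ne_zero.mpr h1.symm
  rw [completedRiemannZeta_eq, xi]
  field_simp
  ring

theorem xi_eq_of_re_pos (s : ℂ) (hs : 0 < s.re) (h1 : s ≠ 1) :
    xi s = s * (s - 1) * ((Real.pi : ℂ) ^ (-s / 2) * Complex.Gamma (s / 2) * riemannZeta s) := by
  have h0 : s ≠ 0 := by rintro rfl; simp at hs
  rw [xi_eq s h0 h1, riemannZeta_def_of_ne_zero h0, ← Complex.Gammaℝ_def,
    mul_div_cancel₀ _ (Complex.Gammaℝ_ne_zero_of_re_pos hs)]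

variable {ι M N : Type*} [Fintype ι] [AddCommGroup M] [Module ℝ M] [AddCommGroup N] [Module ℝ N]

/-- The Weyl group of a finite root system is finite. -/
instance finite_weylGroup (P : RootPairing ι ℝ M N) [P.IsRootSystem] : Finite P.weylGroup := by
  refine Finite.of_injective (P.weylGroupToPerm) ?_
  intro g h hgh
  apply Subtype.ext
  apply RootPairing.Equiv.weightHom_injective P
  apply LinearEquiv.toLinearMap_injective
  refine LinearMap.ext_on_range (v := P.root) (RootPairing.IsRootSystem.span_root_eq_top) ?_
  intro i
  have hg := P.weylGroup_apply_root g i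
  have hh := P.weylGroup_apply_root h i
  rw [hgh, ← hh] at hg
  exact hg

variable {P : RootPairing ι ℝ M N} [P.IsRootSystem] (b : P.Base) (p : b.support)

/-- The fundamental weight `λ_p`: the vector with `⟨λ_p, α_j^∨⟩ = δ_{pj}` for all simple `α_j`. -/
def fundamentalWeight : M :=
  P.toLinearMap.toPerfPair.symm (b.toCoweightBasis.coord p)

theorem fundamentalWeight_coroot (j : b.support) :
    P.toLinearMap (fundamentalWeight b p) (P.coroot j) = if j = p then 1 else 0 := by
  rw [fundamentalWeight, LinearMap.apply_symm_toPerfPair_self]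
  simp [Finsupp.single_apply]

/-- The Weyl vector `ρ`, half the sum of the positive roots. -/
def weylVector : M :=
  (1 / 2 : ℝ) • ∑ i with b.IsPos i, P.root i

/-- `⟨λ_p, α^∨⟩`, where `α` is the root with index `i`. -/
def lam (i : ι) : ℝ := P.toLinearMap (fundamentalWeight b p) (P.coroot i)

/-- The height `ht α^∨ = ⟨ρ, α^∨⟩`, where `α` is the root with index `i`. -/
def ht (i : ι) : ℝ := P.toLinearMap (weylVector b) (P.coroot i)

/-- `wα` is a positive root, that is, `α ∈ w⁻¹Φ⁺`.  Its negation says `α ∈ w⁻¹Φ⁻`. -/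
def PosAt (w : P.weylGroup) (i : ι) : Prop := b.IsPos (P.weylGroupToPerm w i)

/-- `δ_{α,w}`, equal to `1` if `α ∈ w⁻¹Φ⁺` and to `0` if `α ∈ w⁻¹Φ⁻`. -/
def delta (w : P.weylGroup) (i : ι) : ℝ := if PosAt b w i then 1 else 0

/-- `Δ_p = Δ \ {α_p}`. -/
def simpleOff : Finset ι := b.support.erase p

/-- `Φ⁺ \ Φ_p⁺`, where `Φ_p` is the set of roots orthogonal to `λ_p`. -/
def posOff : Finset ι := {i | b.IsPos i ∧ lam b p i ≠ 0}

/-- `Φ_p⁺`. -/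
def posLevi : Finset ι := {i | b.IsPos i ∧ lam b p i = 0}

/-- `𝔚_p = {w ∈ W : Δ_p ⊆ w⁻¹(Δ ∪ Φ⁻)}`. -/
def frakW : Finset P.weylGroup :=
  (Set.toFinite {w : P.weylGroup | ∀ i ∈ simpleOff b p,
    P.weylGroupToPerm w i ∈ b.support ∨ ¬ PosAt b w i}).toFinset

theorem one_mem_frakW : (1 : P.weylGroup) ∈ frakW b p := by
  simp only [frakW, Set.Finite.mem_toFinset, Set.mem_ofPred_eq]
  intro i hi
  left
  rw [map_one]
  exact Finset.mem_of_mem_erase hi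

/-- The linear polynomial `⟨λ_p, α^∨⟩ s + ht α^∨ + c` in the variable `s`. -/
def linPoly (i : ι) (c : ℝ) : ℂ[X] :=
  C (lam b p i : ℂ) * X + C ((ht b i + c : ℝ) : ℂ)

/-- The polynomial
`2^{|Δ_p ∩ v⁻¹Φ⁺|} ∏_{α ∈ v⁻¹Δ \ Δ_p} (⟨λ_p, α^∨⟩ s + ht α^∨ - 1)
∏_{α ∈ Φ⁺ \ Δ_p} (⟨λ_p, α^∨⟩ s + ht α^∨ + δ_{α,v}) (⟨λ_p, α^∨⟩ s + ht α^∨ + δ_{α,v} - 1)`. -/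
def factorPoly (v : P.weylGroup) : ℂ[X] :=
  2 ^ ((simpleOff b p).filter fun i => PosAt b v i).card *
    (∏ i with P.weylGroupToPerm v i ∈ b.support ∧ i ∉ simpleOff b p, linPoly b p i (-1)) *
    ∏ i with b.IsPos i ∧ i ∉ simpleOff b p,
      linPoly b p i (delta b v i) * linPoly b p i (delta b v i - 1)

/-- `Q̃_{p,w}`. -/
def QTilde (w : P.weylGroup) : ℂ[X] := ∏ v ∈ (frakW b p).erase w, factorPoly b p v

/-- `C_{p,w} = ξ(2)^{|Δ_p ∩ w⁻¹Φ⁺|} ∏_{α ∈ Φ_p⁺ \ Δ_p} ξ(ht α^∨ + δ_{α,w})`. -/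
def constC (w : P.weylGroup) : ℂ :=
  xi 2 ^ ((simpleOff b p).filter fun i => PosAt b w i).card *
    ∏ i ∈ posLevi b p \ simpleOff b p, xi ((ht b i + delta b w i : ℝ) : ℂ)

/-- `Q_{p,w} = C_{p,w} Q̃_{p,w}`. -/
def Qpw (w : P.weylGroup) : ℂ[X] := C (constC b p w) * QTilde b p w

/-- `X_{p,w}(s) = ∏_{α ∈ Φ⁺ \ Φ_p⁺} ξ(⟨λ_p, α^∨⟩ s + ht α^∨ + δ_{α,w})`. -/
def Xpw (w : P.weylGroup) (s : ℂ) : ℂ :=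
  ∏ i ∈ posOff b p, xi ((lam b p i : ℂ) * s + ((ht b i + delta b w i : ℝ) : ℂ))

/-- `l_p(w) = |(Φ⁺ \ Φ_p⁺) ∩ w⁻¹Φ⁻|`. -/
def lp (w : P.weylGroup) : ℕ := ((posOff b p).filter fun i => ¬ PosAt b w i).card

/-- `𝔚_p⁺ = {w ∈ 𝔚_p : l_p(w) < |Φ⁺ \ Φ_p⁺| / 2}`. -/
def frakWPos : Finset P.weylGroup := (frakW b p).filter fun w => 2 * lp b p w < (posOff b p).card

/-- `𝔚_p⁰ = {w ∈ 𝔚_p : l_p(w) = |Φ⁺ \ Φ_p⁺| / 2}`. -/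
def frakWZero : Finset P.weylGroup := (frakW b p).filter fun w => 2 * lp b p w = (posOff b p).card

/-- `E_p(s)`. -/
def E (s : ℂ) : ℂ :=
  ∑ w ∈ frakWPos b p, (Qpw b p w).eval s * Xpw b p w s +
    (1 / 2) * ∑ w ∈ frakWZero b p, (Qpw b p w).eval s * Xpw b p w s

/-- `N_{p,w}(k,h) = |{α ∈ w⁻¹Φ⁻ : ⟨λ_p, α^∨⟩ = k, ht α^∨ = h}|`. -/
def Npw (w : P.weylGroup) (k h : ℤ) : ℕ :=
  (Finset.univ.filter fun i => ¬ PosAt b w i ∧ lam b p i = k ∧ ht b i = h).card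

/-- `N_p(k,h) = |{α ∈ Φ : ⟨λ_p, α^∨⟩ = k, ht α^∨ = h}|`. -/
def Np (k h : ℤ) : ℕ :=
  (Finset.univ.filter fun i => lam b p i = k ∧ ht b i = h).card

/-- `M_p(k,h) = max_{w ∈ 𝔚_p} (N_{p,w}(k,h-1) - N_{p,w}(k,h))`. -/
def Mp (k h : ℤ) : ℤ :=
  (frakW b p).sup' ⟨1, one_mem_frakW b p⟩
    fun w => (Npw b p w k (h - 1) : ℤ) - (Npw b p w k h : ℤ)

/-- The exponent `N_p(k,h-1) - M_p(k,h)` of `ξ(ks+h)` in `D_p(s)`. -/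
def expD (k h : ℤ) : ℤ := (Np b p k (h - 1) : ℤ) - Mp b p k h

/-- Only finitely many exponents are nonzero, so that the product defining `D_p` is finite. -/
theorem finite_expD_ne_zero : {x : ℤ × ℤ | expD b p x.1 x.2 ≠ 0}.Finite := by
  refine Set.Finite.subset (s := ⋃ i : ι, ⋃ e : Fin 2,
    {x : ℤ × ℤ | lam b p i = x.1 ∧ ht b i = x.2 - (e : ℕ)}) ?_ ?_
  · refine Set.finite_iUnion fun i => Set.finite_iUnion fun e => Set.Subsingleton.finite ?_
    rintro ⟨k, h⟩ ⟨h1, h2⟩ ⟨k', h'⟩ ⟨h3, h4⟩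
    simp only at h1 h2 h3 h4
    refine Prod.ext ?_ ?_
    · exact_mod_cast h1.symm.trans h3
    · have : (h : ℝ) = h' := by linarith
      exact_mod_cast this
  · rintro ⟨k, h⟩ hx
    by_contra hcon
    simp only [Set.mem_iUnion, Set.mem_ofPred_eq, not_exists, not_and] at hcon
    have a0 : ∀ i, lam b p i = k → ht b i ≠ h := fun i hi => by simpa using hcon i 0 hi
    have a1 : ∀ i, lam b p i = k → ht b i ≠ ((h - 1 : ℤ) : ℝ) :=
      fun i hi => by simpa using hcon i 1 hi
    apply hx
    have e1 : Np b p k (h - 1) = 0 := by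
      rw [Np, Finset.card_eq_zero, Finset.filter_eq_empty_iff]
      exact fun i _ hi => a1 i hi.1 hi.2
    have e2 : ∀ w, Npw b p w k (h - 1) = 0 := fun w => by
      rw [Npw, Finset.card_eq_zero, Finset.filter_eq_empty_iff]
      exact fun i _ hi => a1 i hi.2.1 hi.2.2
    have e3 : ∀ w, Npw b p w k h = 0 := fun w => by
      rw [Npw, Finset.card_eq_zero, Finset.filter_eq_empty_iff]
      exact fun i _ hi => a0 i hi.2.1 hi.2.2
    have e4 : Mp b p k h = 0 := by
      simp only [Mp, e2, e3, Nat.cast_zero, sub_zero]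
      exact Finset.sup'_const _ _
    simp [expD, e1, e4]

/-- `D_p(s) = ∏_{k ≥ 1} ∏_{h ≥ 2} ξ(ks+h)^{N_p(k,h-1) - M_p(k,h)}`. -/
def D (s : ℂ) : ℂ :=
  ∏ᶠ x ∈ {x : ℤ × ℤ | 1 ≤ x.1 ∧ 2 ≤ x.2},
    xi ((x.1 : ℂ) * s + (x.2 : ℂ)) ^ expD b p x.1 x.2

/-- `R_p`, the monic greatest common divisor of the polynomials `Q_{p,w}`, `w ∈ 𝔚_p`, as the
normalized generator of the ideal they span in `ℂ[X]`. -/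
def R : ℂ[X] :=
  normalize (Submodule.IsPrincipal.generator (Ideal.span (Qpw b p '' (frakW b p : Set P.weylGroup))))

theorem dvd_R_iff (q : ℂ[X]) : q ∣ R b p ↔ ∀ w ∈ frakW b p, q ∣ Qpw b p w := by
  rw [R, dvd_normalize_iff]
  constructor
  · intro h w hw
    refine h.trans ((Submodule.IsPrincipal.mem_iff_generator_dvd _).mp ?_)
    exact Ideal.subset_span ⟨w, hw, rfl⟩
  · intro h
    have h1 : Ideal.span (Qpw b p '' (frakW b p : Set P.weylGroup)) ≤ Ideal.span {q} := by
      rw [Ideal.span_le]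
      rintro _ ⟨w, hw, rfl⟩
      exact Ideal.mem_span_singleton.mpr (h w hw)
    exact Ideal.mem_span_singleton.mp (h1 (Submodule.IsPrincipal.generator_mem _))

/-- `ε_p(s) = E_p(s) / (R_p(s) D_p(s))`, computed pointwise.  Where `R_p(s) D_p(s) = 0` the value
is `0`, so a statement `ε_p(s) ≠ 0` includes that the denominator does not vanish at `s`. -/
def eps (s : ℂ) : ℂ := E b p s / ((R b p).eval s * D b p s)

end

end WengZeta

/-! Put s = -z, with Re z large. The functional equation ξ(1 - s) = ξ(s) turns each factor of
X_{p,w}(-z) into ξ(x) or ξ(x + 1), where x = kz - h, k is the level and h is the height of the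
coroot; the second case occurs exactly when w makes the root negative. Hence X_{p,w}/X_{p,1} is a
product of quotients ξ(x + 1)/ξ(x) over the inversions of w outside the Levi part. Each quotient
splits into an elementary and Gamma part `xiRatio x` and the zeta part ζ(x + 1)/ζ(x). Since Q_{p,w}
= C_{p,w} ∏_{v ≠ w} f_v with f_v = `factorPoly b p v`, this gives (`eventually_E_neg`) E_p(-z) =
c(z) ∑_w V_w(z) L(a_w, z), where c(z) ≠ 0, with V_w built from C_{p,w}/f_w(-z) and Gamma quotients,
and a_w multiplicative.

Collect the Dirichlet series by n: the coefficient of n^{-z} is G_n = ∑_w a_w(n) V_w. Let n be the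
first index for which G_n is not identically zero far to the right. If G_n has exact order z^e
there, the terms beyond n are smaller by a factor |z|^B (n/(n+1))^{Re z}, which is negligible once
Re z exceeds a large multiple of log(|Im z| + 10) (`exists_region_sum_ne_zero`). Two things remain.

Exact order of G_n. The V_w are hypergeometric in the sense that V_w(z + 2)/V_w(z) is rational and
V_w ~ c z^a. Cancellation in a finite sum of such functions is handled by induction on the number of
terms (`sum_eventually_zero_or_asymptotic`): divide by a dominant term, take the difference under z
↦ z + 2, which kills that term, and sum back by telescoping.

Existence of n. If w has inversions, a_w is nonzero at a fixed positive power of every prime,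
whereas a_w is the convolution identity if w has none. Combining the coefficients at suitable
integers isolates the elements without inversions (`eventually_sum_eq_zero_of_forall_coeff`), so if
all G_n vanished, then so would ∑ C_{p,w}/f_w(-z) over those elements. Among them, the ones sending
α_p to a simple root permute the simple roots and contribute identical terms with a pole at z = 0;
the others are regular there. This is impossible, so n exists.

For ε_p it only remains that R_p and D_p have no zeros far to the left. Since log(|Im s| + 10) ≥ 1,
enlarging κ places the region in any prescribed left half-plane. -/

namespace WengZeta
open Filter Topology Polynomial

/-! ### Asymptotics in right half-planes and the difference operator of step 2 -/

/-- The filter of complex numbers with real part tending to `+∞`. -/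
def reTop : Filter ℂ := comap Complex.re atTop

theorem eventually_reTop {p : ℂ → Prop} :
    (∀ᶠ z in reTop, p z) ↔ ∃ x₀ : ℝ, ∀ z : ℂ, x₀ ≤ z.re → p z := by
  rw [reTop, (atTop_basis.comap Complex.re).eventually_iff]
  simp

instance reTop_neBot : reTop.NeBot :=
  comap_neBot_iff_frequently.mpr (Eventually.frequently (Eventually.of_forall fun x =>
    ⟨(x : ℂ), by simp⟩))

theorem tendsto_re_reTop : Tendsto Complex.re reTop atTop := tendsto_comap

theorem tendsto_norm_reTop : Tendsto (fun z : ℂ => ‖z‖) reTop atTop :=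
  tendsto_atTop_mono (fun z => Complex.re_le_norm z) tendsto_re_reTop

theorem eventually_re_ge (x : ℝ) : ∀ᶠ z in reTop, x ≤ z.re :=
  tendsto_re_reTop.eventually_ge_atTop x

theorem eventually_ne_zero_reTop : ∀ᶠ z : ℂ in reTop, z ≠ 0 := by
  filter_upwards [eventually_re_ge 1] with z hz h
  rw [h] at hz
  norm_num at hz

theorem tendsto_inv_reTop : Tendsto (fun z : ℂ => z⁻¹) reTop (𝓝 0) := by
  rw [tendsto_zero_iff_norm_tendsto_zero]
  simp only [norm_inv]
  exact tendsto_inv_atTop_zero.comp tendsto_norm_reTop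

theorem tendsto_affine_reTop {k : ℝ} (hk : 0 < k) (c : ℂ) :
    Tendsto (fun z : ℂ => (k : ℂ) * z + c) reTop reTop := by
  refine tendsto_comap_iff.mpr ?_
  have : (Complex.re ∘ fun z : ℂ => (k : ℂ) * z + c) = fun z => k * z.re + c.re := by
    ext z; simp
  rw [this]
  exact tendsto_atTop_add_const_right _ _ (tendsto_re_reTop.const_mul_atTop hk)

theorem tendsto_add_reTop (c : ℂ) : Tendsto (fun z : ℂ => z + c) reTop reTop := by
  simpa using tendsto_affine_reTop one_pos c

/-- Both arguments lie in (-π/2, π/2), so their sum stays within the principal branch of the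
logarithm. -/
theorem mul_cpow_of_re_pos {z u : ℂ} (hz : 0 < z.re) (hu : 0 < u.re) (a : ℂ) :
    (z * u) ^ a = z ^ a * u ^ a := by
  have hz0 : z ≠ 0 := by rintro rfl; simp at hz
  have hu0 : u ≠ 0 := by rintro rfl; simp at hu
  have h1 := abs_lt.mp (Complex.abs_arg_lt_pi_div_two_iff.mpr (Or.inl hz))
  have h2 := abs_lt.mp (Complex.abs_arg_lt_pi_div_two_iff.mpr (Or.inl hu))
  rw [Complex.cpow_def_of_ne_zero (mul_ne_zero hz0 hu0), Complex.cpow_def_of_ne_zero hz0,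
    Complex.cpow_def_of_ne_zero hu0, Complex.log_mul hz0 hu0 ⟨by linarith, by linarith⟩,
    ← Complex.exp_add, add_mul]

theorem tendsto_affine_div_reTop (k c : ℂ) :
    Tendsto (fun z : ℂ => (k * z + c) / z) reTop (𝓝 k) := by
  have h : Tendsto (fun z : ℂ => k + c * z⁻¹) reTop (𝓝 (k + c * 0)) :=
    (tendsto_inv_reTop.const_mul c).const_add k
  rw [mul_zero, add_zero] at h
  refine h.congr' ?_
  filter_upwards [eventually_ne_zero_reTop] with z hz
  field_simp

theorem tendsto_cpow_affine_div {k : ℝ} (hk : 0 < k) (c a : ℂ) :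
    Tendsto (fun z : ℂ => ((k : ℂ) * z + c) ^ a / z ^ a) reTop (𝓝 ((k : ℂ) ^ a)) := by
  have h0 := tendsto_affine_div_reTop k c
  have hsl : (k : ℂ) ∈ Complex.slitPlane := Or.inl (by simpa using hk)
  have h1 : Tendsto (fun z : ℂ => (((k : ℂ) * z + c) / z) ^ a) reTop (𝓝 ((k : ℂ) ^ a)) :=
    (continuousAt_cpow_const hsl).tendsto.comp h0
  refine h1.congr' ?_
  have h2 : ∀ᶠ z : ℂ in reTop, 0 < (((k : ℂ) * z + c) / z).re := by
    have : Tendsto (fun z : ℂ => (((k : ℂ) * z + c) / z).re) reTop (𝓝 ((k : ℂ)).re) :=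
      (Complex.continuous_re.tendsto _).comp h0
    exact this.eventually_const_lt (by simpa using hk)
  filter_upwards [h2, eventually_re_ge 1, eventually_ne_zero_reTop] with z h2 h3 h4
  have h5 : (k : ℂ) * z + c = z * (((k : ℂ) * z + c) / z) := by field_simp
  conv_rhs => rw [h5, mul_cpow_of_re_pos (by linarith) h2]
  rw [mul_div_cancel_left₀]
  simp [Complex.cpow_eq_zero_iff, h4]

/-- With u = 1/z the quotient is the difference quotient at u = 0 of (1 + 2u)^e, whose derivative
there is 2e. -/
theorem tendsto_cpow_sub_cpow (e : ℂ) :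
    Tendsto (fun z : ℂ => ((z + 2) ^ e - z ^ e) / z ^ (e - 1)) reTop (𝓝 (2 * e)) := by
  have hd : HasDerivAt (fun u : ℂ => (1 + 2 * u) ^ e) (2 * e) 0 := by
    have h1 : HasDerivAt (fun u : ℂ => 1 + 2 * u) 2 0 := by
      simpa using ((hasDerivAt_id (0 : ℂ)).const_mul 2).const_add 1
    have h2 := h1.cpow_const (c := e) (by simp)
    simpa [mul_comm] using h2
  have h3 : Tendsto (fun z : ℂ => z⁻¹) reTop (𝓝[≠] 0) := by
    refine tendsto_nhdsWithin_iff.mpr ⟨tendsto_inv_reTop, ?_⟩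
    filter_upwards [eventually_ne_zero_reTop] with z hz
    simpa using hz
  have h4 := (hasDerivAt_iff_tendsto_slope.mp hd).comp h3
  refine h4.congr' ?_
  filter_upwards [eventually_re_ge 3] with z hz
  have hz0 : z ≠ 0 := by rintro rfl; norm_num at hz
  have hpos : 0 < (1 + 2 * z⁻¹).re := by
    have : ‖(2 : ℂ) * z⁻¹‖ < 1 := by
      rw [norm_mul, norm_inv, ← div_eq_mul_inv, div_lt_one (norm_pos_iff.mpr hz0)]
      have := Complex.re_le_norm z
      norm_num; linarith
    have h5 := neg_abs_le (2 * z⁻¹ : ℂ).re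
    have h6 := Complex.abs_re_le_norm (2 * z⁻¹ : ℂ)
    rw [Complex.add_re, Complex.one_re]
    linarith
  have h5 : z + 2 = z * (1 + 2 * z⁻¹) := by field_simp
  have hz1 : z ^ e ≠ 0 := by simp [Complex.cpow_eq_zero_iff, hz0]
  simp only [Function.comp_apply, slope, vsub_eq_sub, sub_zero, smul_eq_mul, inv_inv, mul_zero,
    add_zero, Complex.one_cpow]
  rw [h5, mul_cpow_of_re_pos (by linarith) hpos, Complex.cpow_sub _ _ hz0, Complex.cpow_one]
  field_simp

/-- By the mean value theorem the difference of the (b + 1)-th powers is a positive multiple of x^b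
for some x between r and r + 2 ≤ 3r, so x^b and r^b are comparable. It makes sums of b-th powers
along steps of 2 telescope. -/
theorem exists_rpow_le_telescope {b : ℝ} (hb : b < -1) :
    ∃ K : ℝ, 0 < K ∧ ∀ r : ℝ, 1 ≤ r → r ^ b ≤ K * (r ^ (b + 1) - (r + 2) ^ (b + 1)) := by
  refine ⟨(3 : ℝ) ^ (-b) / (2 * (-(b + 1))), by positivity [show 0 < -(b + 1) by linarith], ?_⟩
  intro r hr
  obtain ⟨x, hx, hx'⟩ := exists_hasDerivAt_eq_slope (fun x : ℝ => x ^ (b + 1))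
    (fun x => (b + 1) * x ^ b) (show r < r + 2 by linarith)
    (ContinuousOn.rpow_const continuousOn_id fun x hx => Or.inl (by
      have := hx.1; linarith))
    (fun x hx => by
      simpa using Real.hasDerivAt_rpow_const (p := b + 1) (Or.inl (by linarith [hx.1] : x ≠ 0)))
  have h1 : r ^ (b + 1) - (r + 2) ^ (b + 1) = 2 * (-(b + 1)) * x ^ b := by
    have : (r + 2 - r) = 2 := by ring
    rw [this] at hx'
    linarith
  have h2 : (3 * r) ^ b ≤ x ^ b :=
    Real.rpow_le_rpow_of_nonpos (by linarith [hx.1]) (by linarith [hx.2]) (by linarith)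
  rw [Real.mul_rpow (by norm_num) (by linarith)] at h2
  have h3 : (3 : ℝ) ^ (-b) * 3 ^ b = 1 := by
    rw [← Real.rpow_add (by norm_num)]; simp
  have h4 : 0 < (3 : ℝ) ^ (-b) := by positivity
  rw [h1]
  have h5 : b + 1 ≠ 0 := by linarith
  calc r ^ b = (3 : ℝ) ^ (-b) * (3 ^ b * r ^ b) := by rw [← mul_assoc, h3, one_mul]
    _ ≤ (3 : ℝ) ^ (-b) * x ^ b := by gcongr
    _ = _ := by field_simp

theorem norm_add_two_mul_ge {z : ℂ} (hz : 0 ≤ z.re) (n : ℕ) :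
    (‖z‖ + 2 * n) / 2 ≤ ‖z + 2 * n‖ := by
  have h1 : (2 * n : ℝ) ≤ ‖z + 2 * n‖ := by
    refine le_trans ?_ (Complex.re_le_norm _)
    simp [hz]
  have h2 : ‖z‖ ≤ ‖z + 2 * n‖ := by
    have hn : (0 : ℝ) ≤ n := n.cast_nonneg
    rw [Complex.norm_def, Complex.norm_def]
    apply Real.sqrt_le_sqrt
    simp only [Complex.normSq_apply, Complex.add_re, Complex.add_im, Complex.mul_re,
      Complex.mul_im, Complex.re_ofNat, Complex.im_ofNat, Complex.natCast_re, Complex.natCast_im]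
    nlinarith [mul_nonneg hz hn]
  linarith

/-- A function which tends to zero at infinity is controlled by its increments. -/
theorem exists_norm_le_of_norm_increment_le {b : ℝ} (hb : b < -1) :
    ∃ K : ℝ, 0 < K ∧ ∀ (Y : ℂ → ℂ) (ε x₀ : ℝ), 0 ≤ ε → 1 ≤ x₀ →
      (∀ z : ℂ, x₀ ≤ z.re → ‖Y (z + 2) - Y z‖ ≤ ε * ‖z‖ ^ b) → Tendsto Y reTop (𝓝 0) →
      ∀ z : ℂ, x₀ ≤ z.re → ‖Y z‖ ≤ K * ε * ‖z‖ ^ (b + 1) := by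
  obtain ⟨K, hK, hKb⟩ := exists_rpow_le_telescope hb
  refine ⟨2 ^ (-b) * K, by positivity, ?_⟩
  intro Y ε x₀ hε hx₀ hY hlim z hz
  have hzn : 1 ≤ ‖z‖ := by linarith [Complex.re_le_norm z]
  set φ : ℕ → ℝ := fun n => (‖z‖ + 2 * n) ^ (b + 1) with hφ
  have hstep : ∀ n : ℕ, ‖Y (z + 2 * (n + 1 : ℕ)) - Y (z + 2 * n)‖ ≤
      2 ^ (-b) * K * ε * (φ n - φ (n + 1)) := by
    intro n
    have hn : (0 : ℝ) ≤ n := n.cast_nonneg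
    have h1 := hY (z + 2 * n) (by simp; linarith)
    have h2 : ‖z + 2 * n‖ ^ b ≤ ((‖z‖ + 2 * n) / 2) ^ b :=
      Real.rpow_le_rpow_of_nonpos (by linarith)
        (norm_add_two_mul_ge (by linarith) n) (by linarith)
    rw [Real.div_rpow (by linarith) (by norm_num), div_eq_mul_inv,
      ← Real.rpow_neg (by norm_num)] at h2
    have h3 := hKb (‖z‖ + 2 * n) (by linarith)
    have h4 : z + 2 * (n : ℂ) + 2 = z + 2 * ((n + 1 : ℕ) : ℂ) := by push_cast; ring
    have h5 : φ (n + 1) = (‖z‖ + 2 * n + 2) ^ (b + 1) := by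
      simp only [hφ]; push_cast; ring_nf
    rw [h4] at h1
    calc _ ≤ ε * ‖z + 2 * n‖ ^ b := h1
      _ ≤ ε * ((K * (φ n - φ (n + 1))) * 2 ^ (-b)) := by
        rw [h5]
        refine mul_le_mul_of_nonneg_left (h2.trans ?_) hε
        gcongr
      _ = _ := by ring
  -- Y is recovered from its value far to the right, which tends to zero, plus a telescoping sum of
  -- increments.
  have hsum : ∀ n : ℕ, ‖Y z‖ ≤ ‖Y (z + 2 * n)‖ + 2 ^ (-b) * K * ε * (φ 0 - φ n) := by
    intro n
    induction n with
    | zero => simp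
    | succ n ih =>
      have h1 := hstep n
      have h2 : ‖Y (z + 2 * n)‖ ≤ ‖Y (z + 2 * (n + 1 : ℕ))‖ +
          ‖Y (z + 2 * (n + 1 : ℕ)) - Y (z + 2 * n)‖ := by
        rw [norm_sub_rev]
        have := norm_add_le (Y (z + 2 * (n + 1 : ℕ))) (Y (z + 2 * n) - Y (z + 2 * (n + 1 : ℕ)))
        simpa using this
      linarith
  have hseq : Tendsto (fun n : ℕ => z + 2 * (n : ℂ)) atTop reTop := by
    refine tendsto_comap_iff.mpr ?_
    have : (Complex.re ∘ fun n : ℕ => z + 2 * (n : ℂ)) = fun n : ℕ => z.re + 2 * (n : ℝ) := by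
      ext n; simp
    rw [this]
    exact tendsto_atTop_add_const_left _ _
      ((tendsto_natCast_atTop_atTop).const_mul_atTop two_pos)
  have hlim' : Tendsto (fun n : ℕ => ‖Y (z + 2 * n)‖ + 2 ^ (-b) * K * ε * φ 0) atTop
      (𝓝 (0 + 2 ^ (-b) * K * ε * φ 0)) := by
    have := (hlim.comp hseq).norm
    rw [norm_zero] at this
    exact this.add_const _
  have hφ0 : φ 0 = ‖z‖ ^ (b + 1) := by simp [hφ]
  rw [hφ0, zero_add] at hlim'
  refine ge_of_tendsto' hlim' fun n => (hsum n).trans ?_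
  have : 0 ≤ φ n := by positivity
  have h6 : 0 ≤ 2 ^ (-b) * K * ε := by positivity
  rw [← hφ0]
  nlinarith

/-- If `U → 0` and the increments of `U` are asymptotic to `c z^b` with `b < -1`, then `U` is
asymptotic to `c / (2 (b + 1)) z^{b+1}`. -/
theorem tendsto_div_cpow_of_increment {U : ℂ → ℂ} {b : ℝ} (hb : b < -1) {c : ℂ}
    (hU : Tendsto U reTop (𝓝 0))
    (hD : Tendsto (fun z => (U (z + 2) - U z) / z ^ (b : ℂ)) reTop (𝓝 c)) :
    Tendsto (fun z => U z / z ^ ((b + 1 : ℝ) : ℂ)) reTop (𝓝 (c / (2 * (b + 1)))) := by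
  obtain ⟨K, hK, hKb⟩ := exists_norm_le_of_norm_increment_le hb
  have hb1 : (b : ℂ) + 1 ≠ 0 := by
    have : (b + 1 : ℝ) ≠ 0 := by linarith
    exact_mod_cast this
  -- The difference of m z^{b+1} is asymptotic to 2(b + 1) m z^b, so this m cancels the leading term
  -- of the increments. The remainder Y has increments o(z^b), hence is o(z^{b+1}).
  set m : ℂ := c / (2 * (b + 1)) with hm
  set Y : ℂ → ℂ := fun z => U z - m * z ^ ((b + 1 : ℝ) : ℂ) with hYdef
  have hpow0 : Tendsto (fun z : ℂ => z ^ ((b + 1 : ℝ) : ℂ)) reTop (𝓝 0) := by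
    rw [tendsto_zero_iff_norm_tendsto_zero]
    simp only [Complex.norm_cpow_real]
    have := (tendsto_rpow_neg_atTop (show 0 < -(b + 1) by linarith)).comp tendsto_norm_reTop
    simpa [Function.comp_def] using this
  have hY0 : Tendsto Y reTop (𝓝 0) := by
    simpa [hYdef] using hU.sub (hpow0.const_mul m)
  have hYD : Tendsto (fun z => (Y (z + 2) - Y z) / z ^ (b : ℂ)) reTop (𝓝 0) := by
    have h1 := tendsto_cpow_sub_cpow ((b + 1 : ℝ) : ℂ)
    have h2 := hD.sub (h1.const_mul m)
    have h3 : c - m * (2 * ((b + 1 : ℝ) : ℂ)) = 0 := by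
      rw [hm]; push_cast; field_simp; ring
    rw [h3] at h2
    refine h2.congr fun z => ?_
    have h4 : (((b + 1 : ℝ) : ℂ) - 1) = b := by push_cast; ring
    rw [h4]
    simp only [hYdef]
    ring
  have hYlim : Tendsto (fun z => Y z / z ^ ((b + 1 : ℝ) : ℂ)) reTop (𝓝 0) := by
    rw [Metric.tendsto_nhds]
    intro ε hε
    have h1 : ∀ᶠ z in reTop, ‖(Y (z + 2) - Y z) / z ^ (b : ℂ)‖ < ε / (2 * K) := by
      have := (Metric.tendsto_nhds.mp hYD) (ε / (2 * K)) (by positivity)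
      simpa using this
    obtain ⟨x₀, hx₀⟩ := eventually_reTop.mp h1
    filter_upwards [eventually_re_ge (max x₀ 1)] with z hz
    have hz0 : ∀ z : ℂ, max x₀ 1 ≤ z.re → 0 < ‖z‖ := fun z hz => by
      have := Complex.re_le_norm z
      have := le_max_right x₀ 1
      linarith
    have h2 := hKb Y (ε / (2 * K)) (max x₀ 1) (by positivity) (le_max_right _ _) (fun z hz => by
      have := (hx₀ z ((le_max_left _ _).trans hz)).le
      rwa [norm_div, Complex.norm_cpow_real, div_le_iff₀ (Real.rpow_pos_of_pos (hz0 z hz) _)]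
        at this) hY0 z hz
    rw [dist_zero_right, norm_div, Complex.norm_cpow_real,
      div_lt_iff₀ (Real.rpow_pos_of_pos (hz0 z hz) _)]
    refine h2.trans_lt ?_
    have h3 : K * (ε / (2 * K)) = ε / 2 := by field_simp
    rw [h3]
    have := Real.rpow_pos_of_pos (hz0 z hz) (b + 1)
    nlinarith
  have h5 := hYlim.add_const m
  rw [zero_add] at h5
  refine h5.congr' ?_
  filter_upwards [eventually_ne_zero_reTop] with z hz
  have : z ^ ((b + 1 : ℝ) : ℂ) ≠ 0 := by
    rw [Ne, Complex.cpow_eq_zero_iff]; tauto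
  simp only [hYdef]
  field_simp
  ring

end WengZeta

/-! ### Hypergeometric functions and the asymptotics of their finite sums -/

namespace WengZeta
open Filter Topology Polynomial

theorem eventually_eval_ne_zero {q : ℂ[X]} (hq : q ≠ 0) : ∀ᶠ z in reTop, q.eval z ≠ 0 := by
  have h : ∀ᶠ z in reTop, ∀ r ∈ q.roots.toFinset, z ≠ r := by
    rw [eventually_all_finset]
    intro r _
    filter_upwards [eventually_re_ge (r.re + 1)] with z hz h
    rw [h] at hz
    linarith
  filter_upwards [h] with z hz h0
  exact hz z (by simpa [hq] using h0) rfl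

theorem tendsto_cpow_reTop_zero {a : ℝ} (ha : a < 0) :
    Tendsto (fun z : ℂ => z ^ (a : ℂ)) reTop (𝓝 0) := by
  rw [tendsto_zero_iff_norm_tendsto_zero]
  simp only [Complex.norm_cpow_real]
  simpa [Function.comp_def] using
    (tendsto_rpow_neg_atTop (show 0 < -a by linarith)).comp tendsto_norm_reTop

theorem cpow_ne_zero_of_ne_zero {z : ℂ} (hz : z ≠ 0) (a : ℂ) : z ^ a ≠ 0 := by
  rw [Ne, Complex.cpow_eq_zero_iff]; tauto

/-- `ρ` is a rational function near `reTop` with `ρ(z) = 1 + 2a/z + o(1/z)`. -/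
structure IsShiftFactor (ρ : ℂ → ℂ) (a : ℝ) : Prop where
  rational : ∃ p q : ℂ[X], q ≠ 0 ∧ ρ =ᶠ[reTop] fun z => p.eval z / q.eval z
  lim : Tendsto (fun z => z * (ρ z - 1)) reTop (𝓝 (2 * a))

theorem IsShiftFactor.tendsto_one {ρ : ℂ → ℂ} {a : ℝ} (h : IsShiftFactor ρ a) :
    Tendsto ρ reTop (𝓝 1) := by
  have h1 := (tendsto_inv_reTop.mul h.lim).add_const 1
  rw [zero_mul, zero_add] at h1
  refine h1.congr' ?_
  filter_upwards [eventually_ne_zero_reTop] with z hz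
  rw [inv_mul_cancel_left₀ hz]
  ring

theorem IsShiftFactor.mul {ρ σ : ℂ → ℂ} {a b : ℝ} (h : IsShiftFactor ρ a)
    (h' : IsShiftFactor σ b) : IsShiftFactor (fun z => ρ z * σ z) (a + b) where
  rational := by
    obtain ⟨p, q, hq, h1⟩ := h.rational
    obtain ⟨p', q', hq', h2⟩ := h'.rational
    refine ⟨p * p', q * q', mul_ne_zero hq hq', ?_⟩
    filter_upwards [h1, h2] with z h1 h2
    rw [h1, h2, eval_mul, eval_mul]
    ring
  lim := by
    have h1 := (h.lim.mul h'.tendsto_one).add h'.lim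
    have h2 : (2 * (a : ℂ) * 1 + 2 * b) = 2 * ((a + b : ℝ) : ℂ) := by push_cast; ring
    rw [h2] at h1
    refine h1.congr fun z => ?_
    ring

theorem IsShiftFactor.inv {ρ : ℂ → ℂ} {a : ℝ} (h : IsShiftFactor ρ a) :
    IsShiftFactor (fun z => (ρ z)⁻¹) (-a) where
  rational := by
    obtain ⟨p, q, hq, h1⟩ := h.rational
    refine ⟨q, p, ?_, ?_⟩
    -- A zero numerator would make ρ eventually zero, although ρ tends to 1.
    · rintro rfl
      have h2 : Tendsto ρ reTop (𝓝 0) := by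
        refine tendsto_const_nhds.congr' (f₁ := fun _ => (0 : ℂ)) ?_
        filter_upwards [h1] with z hz
        simp [hz]
      exact one_ne_zero (tendsto_nhds_unique h.tendsto_one h2)
    · filter_upwards [h1] with z h1
      rw [h1, inv_div]
  lim := by
    have h1 := (h.lim.mul (h.tendsto_one.inv₀ one_ne_zero)).neg
    have h2 : -(2 * (a : ℂ) * 1⁻¹) = 2 * ((-a : ℝ) : ℂ) := by push_cast; ring
    rw [h2] at h1
    refine h1.congr' ?_
    filter_upwards [h.tendsto_one.eventually_ne one_ne_zero] with z hz
    field_simp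
    ring

theorem isShiftFactor_affine {k : ℂ} (hk : k ≠ 0) (c d : ℂ) {a : ℝ} (hd : d = 2 * a * k) :
    IsShiftFactor (fun z => (k * z + c + d) / (k * z + c)) a where
  rational := by
    refine ⟨C k * X + C (c + d), C k * X + C c, ?_, ?_⟩
    · intro h
      have := congrArg (fun p => p.coeff 1) h
      simp [coeff_C] at this
      exact hk this
    · refine Eventually.of_forall fun z => ?_
      simp [add_assoc]
  lim := by
    have h1 := ((tendsto_affine_div_reTop k c).inv₀ hk).const_mul d
    have h2 : d * k⁻¹ = 2 * a := by rw [hd]; field_simp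
    rw [h2] at h1
    refine h1.congr' ?_
    have h3 := (tendsto_affine_div_reTop k c).eventually_ne hk
    filter_upwards [h3, eventually_ne_zero_reTop] with z h3 hz
    have h4 : k * z + c ≠ 0 := by intro h; simp [h] at h3
    field_simp
    ring

theorem isShiftFactor_one : IsShiftFactor (fun _ => 1) 0 where
  rational := ⟨1, 1, one_ne_zero, by simp [EventuallyEq]⟩
  lim := by simp

/-- `f(z)` is asymptotic to a nonzero multiple of `z ^ a`, and `f(z + 2) / f(z)` is rational. -/
structure IsHypergeometric (f : ℂ → ℂ) (a : ℝ) : Prop where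
  asymptotic : ∃ c : ℂ, c ≠ 0 ∧ Tendsto (fun z => f z / z ^ (a : ℂ)) reTop (𝓝 c)
  shift : ∃ ρ, IsShiftFactor ρ a ∧ ∀ᶠ z in reTop, f (z + 2) = ρ z * f z

namespace IsHypergeometric

variable {f g : ℂ → ℂ} {a b : ℝ}

theorem eventually_ne_zero (h : IsHypergeometric f a) : ∀ᶠ z in reTop, f z ≠ 0 := by
  obtain ⟨c, hc, h1⟩ := h.asymptotic
  filter_upwards [h1.eventually_ne hc] with z hz h0
  simp [h0] at hz

theorem congr (h : IsHypergeometric f a) (hfg : f =ᶠ[reTop] g) : IsHypergeometric g a where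
  asymptotic := by
    obtain ⟨c, hc, h1⟩ := h.asymptotic
    refine ⟨c, hc, h1.congr' ?_⟩
    filter_upwards [hfg] with z hz
    rw [hz]
  shift := by
    obtain ⟨ρ, hρ, h1⟩ := h.shift
    refine ⟨ρ, hρ, ?_⟩
    filter_upwards [h1, hfg, (tendsto_add_reTop 2).eventually hfg] with z h1 h2 h3
    rw [← h2, ← h3, h1]

theorem mul (hf : IsHypergeometric f a) (hg : IsHypergeometric g b) :
    IsHypergeometric (fun z => f z * g z) (a + b) where
  asymptotic := by
    obtain ⟨c, hc, h1⟩ := hf.asymptotic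
    obtain ⟨d, hd, h2⟩ := hg.asymptotic
    refine ⟨c * d, mul_ne_zero hc hd, (h1.mul h2).congr' ?_⟩
    filter_upwards [eventually_ne_zero_reTop] with z hz
    rw [Complex.ofReal_add, Complex.cpow_add _ _ hz]
    ring
  shift := by
    obtain ⟨ρ, hρ, h1⟩ := hf.shift
    obtain ⟨σ, hσ, h2⟩ := hg.shift
    refine ⟨_, hρ.mul hσ, ?_⟩
    filter_upwards [h1, h2] with z h1 h2
    rw [h1, h2]
    ring

theorem inv (hf : IsHypergeometric f a) : IsHypergeometric (fun z => (f z)⁻¹) (-a) where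
  asymptotic := by
    obtain ⟨c, hc, h1⟩ := hf.asymptotic
    refine ⟨c⁻¹, inv_ne_zero hc, (h1.inv₀ hc).congr fun z => ?_⟩
    rw [Complex.ofReal_neg, Complex.cpow_neg, inv_div, div_inv_eq_mul, mul_comm, div_eq_mul_inv]
  shift := by
    obtain ⟨ρ, hρ, h1⟩ := hf.shift
    refine ⟨_, hρ.inv, ?_⟩
    filter_upwards [h1] with z h1
    rw [h1, mul_inv]

theorem div (hf : IsHypergeometric f a) (hg : IsHypergeometric g b) :
    IsHypergeometric (fun z => f z / g z) (a - b) := by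
  simpa only [div_eq_mul_inv, sub_eq_add_neg] using hf.mul hg.inv

theorem const {c : ℂ} (hc : c ≠ 0) : IsHypergeometric (fun _ => c) 0 where
  asymptotic := ⟨c, hc, by simp⟩
  shift := ⟨_, isShiftFactor_one, by simp⟩

theorem affine {k : ℂ} (hk : k ≠ 0) (c : ℂ) : IsHypergeometric (fun z => k * z + c) 1 where
  asymptotic := ⟨k, hk, by simpa using tendsto_affine_div_reTop k c⟩
  shift := by
    refine ⟨_, isShiftFactor_affine hk c (2 * k) (by simp), ?_⟩
    have h3 := (tendsto_affine_div_reTop k c).eventually_ne hk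
    filter_upwards [h3] with z h3
    have h4 : k * z + c ≠ 0 := by intro h; simp [h] at h3
    field_simp
    ring

theorem prod {κ : Type*} (s : Finset κ) (F : κ → ℂ → ℂ)
    (h : ∀ i ∈ s, ∃ a, IsHypergeometric (F i) a) :
    ∃ a, IsHypergeometric (fun z => ∏ i ∈ s, F i z) a := by
  classical
  induction s using Finset.induction_on with
  | empty => exact ⟨0, by simpa using const one_ne_zero⟩
  | insert i s hi ih =>
    obtain ⟨a, ha⟩ := h i (Finset.mem_insert_self _ _)
    obtain ⟨b, hb⟩ := ih fun j hj => h j (Finset.mem_insert_of_mem hj)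
    refine ⟨a + b, ?_⟩
    simp only [Finset.prod_insert hi]
    exact ha.mul hb

/-- Over ℂ a nonzero polynomial is a constant times linear factors, each hypergeometric of exponent
1. -/
theorem polynomial {p : ℂ[X]} (hp : p ≠ 0) : ∃ a, IsHypergeometric (fun z => p.eval z) a := by
  have hs : ∀ s : Multiset ℂ, ∃ a, IsHypergeometric
      (fun z => ((s.map fun r => X - C r).prod : ℂ[X]).eval z) a := by
    intro s
    induction s using Multiset.induction_on with
    | empty => exact ⟨0, by simpa using const one_ne_zero⟩
    | cons r s ih =>
      obtain ⟨b, hb⟩ := ih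
      refine ⟨1 + b, ?_⟩
      have h1 := (affine one_ne_zero (-r)).mul hb
      refine h1.congr (Eventually.of_forall fun z => ?_)
      simp [sub_eq_add_neg]
  obtain ⟨a, ha⟩ := hs p.roots
  refine ⟨0 + a, ((const (leadingCoeff_ne_zero.mpr hp)).mul ha).congr
    (Eventually.of_forall fun z => ?_)⟩
  have h2 := (IsAlgClosed.splits p).eq_prod_roots
  change _ = p.eval z
  conv_rhs => rw [h2, eval_mul, eval_C]

end IsHypergeometric

/-- Applied with h = ρ - 1 for a shift factor ρ = 1 + 2d/z + o(1/z): a pure power order for h cannot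
exceed that of 1/z, and must be strictly smaller when the 1/z coefficient vanishes. -/
theorem exponent_add_one_le {h : ℂ → ℂ} {m d : ℝ} (hh : IsHypergeometric h m)
    (hlim : Tendsto (fun z => z * h z) reTop (𝓝 (2 * d))) :
    m + 1 ≤ 0 ∧ (d = 0 → m + 1 < 0) := by
  obtain ⟨c, hc, h1⟩ := hh.asymptotic
  have h2 : m + 1 ≤ 0 ∧ (m + 1 = 0 → d ≠ 0) := by
    constructor
    · by_contra! hm
      have h3 := hlim.mul (tendsto_cpow_reTop_zero (show -(m + 1) < 0 by linarith))
      have h4 : Tendsto (fun z => h z / z ^ (m : ℂ)) reTop (𝓝 (2 * d * 0)) := by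
        refine h3.congr' ?_
        filter_upwards [eventually_ne_zero_reTop] with z hz
        have := cpow_ne_zero_of_ne_zero hz (m : ℂ)
        rw [Complex.ofReal_neg, Complex.cpow_neg, Complex.ofReal_add, Complex.ofReal_one,
          Complex.cpow_add _ _ hz, Complex.cpow_one]
        field_simp
      rw [mul_zero] at h4
      exact hc (tendsto_nhds_unique h1 h4)
    · rintro hm rfl
      have hm' : m = -1 := by linarith
      subst hm'
      have h4 : Tendsto (fun z => z * h z) reTop (𝓝 c) := by
        refine h1.congr' ?_
        filter_upwards [eventually_ne_zero_reTop] with z hz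
        simp only [Complex.ofReal_neg, Complex.ofReal_one, Complex.cpow_neg, Complex.cpow_one]
        field_simp
      have := tendsto_nhds_unique h4 hlim
      simp at this
      exact hc this
  refine ⟨h2.1, fun hd => lt_of_le_of_ne h2.1 fun h0 => h2.2 h0 hd⟩

/-- A finite sum of hypergeometric functions is either eventually zero or asymptotic to a nonzero
multiple of a power of `z`. -/
theorem sum_eventually_zero_or_asymptotic {κ : Type*} (n : ℕ) (s : Finset κ) (hs : s.card = n)
    (f : κ → ℂ → ℂ) (a : κ → ℝ) (hf : ∀ i ∈ s, IsHypergeometric (f i) (a i)) :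
    (∀ᶠ z in reTop, ∑ i ∈ s, f i z = 0) ∨
      ∃ (c : ℂ) (e : ℝ), c ≠ 0 ∧ (∃ i ∈ s, e ≤ a i) ∧
        Tendsto (fun z => (∑ i ∈ s, f i z) / z ^ (e : ℂ)) reTop (𝓝 c) := by
  classical
  induction n using Nat.strong_induction_on generalizing s f a with
  | _ n ih =>
  rcases s.eq_empty_or_nonempty with rfl | hne
  · left; simp
  obtain ⟨m, hm, hmax⟩ := s.exists_max_image a hne
  have hfm := hf m hm
  -- After division by the term of largest exponent, all exponents are at most 0 and the term m is
  -- the constant 1.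
  set u : κ → ℂ → ℂ := fun i z => f i z / f m z with hu
  have hug : ∀ i ∈ s, IsHypergeometric (u i) (a i - a m) := fun i hi => (hf i hi).div hfm
  have hD : ∀ i ∈ s, (∀ᶠ z in reTop, u i (z + 2) - u i z = 0) ∨
      ∃ e : ℝ, e < -1 ∧ IsHypergeometric (fun z => u i (z + 2) - u i z) e := by
    intro i hi
    obtain ⟨ρ, hρ, h1⟩ := (hug i hi).shift
    obtain ⟨p, q, hq, h2⟩ := hρ.rational
    -- The difference of u i is (ρ - 1) u i with ρ - 1 = (p - q)/q: either zero, or hypergeometric.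
    -- In the second case its exponent is below -1, because either u i decays, or its exponent is 0
    -- and ρ - 1 has no 1/z term.
    by_cases hpq : p - q = 0
    · left
      filter_upwards [h1, h2, eventually_eval_ne_zero hq] with z h1 h2 h3
      rw [h1, h2, sub_eq_zero.mp hpq, div_self h3, one_mul, sub_self]
    · right
      obtain ⟨d, hd⟩ := IsHypergeometric.polynomial hpq
      obtain ⟨d', hd'⟩ := IsHypergeometric.polynomial hq
      have h3 := hd.div hd'
      have h4 : (fun z => (p - q).eval z / q.eval z) =ᶠ[reTop] fun z => ρ z - 1 := by
        filter_upwards [h2, eventually_eval_ne_zero hq] with z h2 h3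
        rw [h2, eval_sub]
        field_simp
      have h5 := exponent_add_one_le (h3.congr h4) hρ.lim
      refine ⟨(d - d') + (a i - a m), ?_, ?_⟩
      · have h6 := hmax i hi
        rcases h6.lt_or_eq with h6 | h6
        · linarith [h5.1]
        · linarith [h5.2 (by linarith)]
      · refine (h3.mul (hug i hi)).congr ?_
        filter_upwards [h1, h4] with z h1 h4
        rw [h1, h4]
        ring
  set S : ℂ → ℂ := fun z => ∑ i ∈ s, f i z with hS
  set U : ℂ → ℂ := fun z => ∑ i ∈ s, u i z with hU
  have hSU : ∀ᶠ z in reTop, S z = f m z * U z := by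
    filter_upwards [hfm.eventually_ne_zero] with z hz
    simp only [hS, hU, hu, Finset.mul_sum]
    exact Finset.sum_congr rfl fun i _ => by field_simp
  obtain ⟨c₁, hc₁, hlim₁⟩ := hfm.asymptotic
  have huLim : ∀ i ∈ s, ∃ c, Tendsto (u i) reTop (𝓝 c) := by
    intro i hi
    obtain ⟨c, hc, h1⟩ := (hug i hi).asymptotic
    rcases (hmax i hi).lt_or_eq with h6 | h6
    · refine ⟨c * 0, (h1.mul (tendsto_cpow_reTop_zero
        (show a i - a m < 0 by linarith))).congr' ?_⟩
      filter_upwards [eventually_ne_zero_reTop] with z hz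
      rw [div_mul_cancel₀ _ (cpow_ne_zero_of_ne_zero hz _)]
    · refine ⟨c, h1.congr fun z => ?_⟩
      rw [h6, sub_self]
      simp
  have hULim : ∃ c, Tendsto U reTop (𝓝 c) := by
    choose! c hc using huLim
    exact ⟨_, tendsto_finsetSum s hc⟩
  obtain ⟨c, hc⟩ := hULim
  -- If the normalized sum has a nonzero limit, the dominant term already gives the order. Otherwise
  -- the leading terms cancel, and one passes to differences, which have fewer terms.
  by_cases hc0 : c = 0
  · subst hc0
    set t := (s.erase m).filter fun i => ¬ ∀ᶠ z in reTop, u i (z + 2) - u i z = 0 with ht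
    have hts : t ⊆ s := (Finset.filter_subset _ _).trans (Finset.erase_subset _ _)
    have hum : ∀ᶠ z in reTop, u m (z + 2) - u m z = 0 := by
      filter_upwards [hfm.eventually_ne_zero,
        (tendsto_add_reTop 2).eventually hfm.eventually_ne_zero] with z h1 h2
      simp [hu, div_self h1, div_self h2]
    have hUD : ∀ᶠ z in reTop, U (z + 2) - U z = ∑ i ∈ t, (u i (z + 2) - u i z) := by
      have h1 : ∀ᶠ z in reTop, ∀ i ∈ s, i ∉ t → u i (z + 2) - u i z = 0 := by
        rw [eventually_all_finset]
        intro i hi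
        by_cases hit : i ∈ t
        · exact Eventually.of_forall fun z h => absurd hit h
        · have h2 : ∀ᶠ z in reTop, u i (z + 2) - u i z = 0 := by
            by_cases him : i = m
            · rw [him]; exact hum
            · by_contra h3
              exact hit (by simp only [ht, Finset.mem_filter, Finset.mem_erase]
                            exact ⟨⟨him, hi⟩, h3⟩)
          filter_upwards [h2] with z h2 _ using h2
      filter_upwards [h1] with z h1
      rw [Finset.sum_subset hts fun i hi hit => h1 i hi hit]
      simp only [hU, Finset.sum_sub_distrib]
    have hDt : ∀ i ∈ t, ∃ e : ℝ, e < -1 ∧ IsHypergeometric (fun z => u i (z + 2) - u i z) e :=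
      fun i hi => (hD i (hts hi)).resolve_left (by
        simp only [ht, Finset.mem_filter] at hi
        exact hi.2)
    choose! e he hee using hDt
    have hcard : t.card < n := by
      rw [← hs]
      exact (Finset.card_le_card (Finset.filter_subset _ _)).trans_lt (Finset.card_erase_lt_of_mem hm)
    rcases ih t.card hcard t rfl _ e hee with h1 | ⟨d, b, hd, ⟨i, hi, hb⟩, h1⟩
    · left
      have h2 : ∀ᶠ z in reTop, U (z + 2) - U z = 0 := by
        filter_upwards [h1, hUD] with z h1 h2
        rw [h2, h1]
      -- Increments that are exactly zero satisfy the bound with ε = 0, so U, which tends to zero,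
      -- vanishes. The exponent -2 is an arbitrary number below -1.
      obtain ⟨K, -, hK⟩ := exists_norm_le_of_norm_increment_le (show (-2 : ℝ) < -1 by norm_num)
      obtain ⟨x₀, hx₀⟩ := eventually_reTop.mp h2
      have h3 := hK U 0 (max x₀ 1) le_rfl (le_max_right _ _) (fun z hz => by
        rw [hx₀ z ((le_max_left _ _).trans hz)]; simp) hc
      filter_upwards [eventually_re_ge (max x₀ 1), hSU] with z hz hSU
      have h4 := h3 z hz
      rw [mul_zero, zero_mul, norm_le_zero_iff] at h4
      have : S z = 0 := by rw [hSU, h4, mul_zero]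
      exact this
    · right
      have hb1 : b < -1 := hb.trans_lt (he i hi)
      have h2 : Tendsto (fun z => (U (z + 2) - U z) / z ^ (b : ℂ)) reTop (𝓝 d) := by
        refine h1.congr' ?_
        filter_upwards [hUD] with z hz
        rw [hz]
      have h3 := tendsto_div_cpow_of_increment hb1 hc h2
      have hb2 : (b : ℂ) + 1 ≠ 0 := by
        have : (b + 1 : ℝ) ≠ 0 := by linarith
        exact_mod_cast this
      refine ⟨c₁ * (d / (2 * (b + 1))), a m + (b + 1), by
        refine mul_ne_zero hc₁ (div_ne_zero hd (mul_ne_zero two_ne_zero hb2)),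
        ⟨m, hm, by linarith⟩, (hlim₁.mul h3).congr' ?_⟩
      filter_upwards [hSU, eventually_ne_zero_reTop] with z hz hz0
      change _ = S z / _
      rw [hz, Complex.ofReal_add (a m), Complex.cpow_add _ _ hz0]
      ring
  · right
    refine ⟨c₁ * c, a m, mul_ne_zero hc₁ hc0, ⟨m, hm, le_rfl⟩, (hlim₁.mul hc).congr' ?_⟩
    filter_upwards [hSU] with z hz
    change _ = S z / _
    rw [hz]
    ring

end WengZeta

/-! ### The Gamma quotient Γ((x+1)/2)/Γ(x/2) -/

namespace WengZeta
open Filter Topology Polynomial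

/-- The quotient `Γ((x+1)/2) / Γ(x/2)`. -/
noncomputable def gammaRatio (x : ℂ) : ℂ := Complex.Gamma ((x + 1) / 2) / Complex.Gamma (x / 2)

theorem gammaRatio_ne_zero {x : ℂ} (hx : 0 < x.re) : gammaRatio x ≠ 0 :=
  div_ne_zero (Complex.Gamma_ne_zero_of_re_pos (by simp; linarith))
    (Complex.Gamma_ne_zero_of_re_pos (by simp; linarith))

theorem gammaRatio_add_two {x : ℂ} (hx : 0 < x.re) :
    gammaRatio (x + 2) = (x + 1) / x * gammaRatio x := by
  have hx0 : x ≠ 0 := by rintro rfl; simp at hx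
  have hx1 : x + 1 ≠ 0 := by
    intro h
    have := congrArg Complex.re h
    simp at this
    linarith
  have e1 : (x + 2 + 1) / 2 = (x + 1) / 2 + 1 := by ring
  have e2 : (x + 2) / 2 = x / 2 + 1 := by ring
  rw [gammaRatio, gammaRatio, e1, e2, Complex.Gamma_add_one _ (div_ne_zero hx1 two_ne_zero),
    Complex.Gamma_add_one _ (div_ne_zero hx0 two_ne_zero)]
  have := Complex.Gamma_ne_zero_of_re_pos (s := x / 2) (by simp; linarith)
  field_simp

theorem gammaRatio_add_two_mul {x : ℂ} (hx : 0 < x.re) (k : ℕ) :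
    gammaRatio (x + 2 * k) =
      (∏ j ∈ Finset.range k, (x + 2 * j + 1) / (x + 2 * j)) * gammaRatio x := by
  induction k with
  | zero => simp
  | succ k ih =>
    have : x + 2 * ((k + 1 : ℕ) : ℂ) = x + 2 * k + 2 := by push_cast; ring
    rw [this, gammaRatio_add_two (by simp; positivity), ih, Finset.prod_range_succ]
    ring

theorem Gamma_add_nat_add_one {s : ℂ} (hs : 0 < s.re) (n : ℕ) :
    Complex.Gamma (s + n + 1) = (∏ j ∈ Finset.range (n + 1), (s + j)) * Complex.Gamma s := by
  have h0 : ∀ n : ℕ, s + n ≠ 0 := fun n h => by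
    have := congrArg Complex.re h
    simp at this
    linarith [(n.cast_nonneg : (0 : ℝ) ≤ n)]
  induction n with
  | zero => simpa using Complex.Gamma_add_one s (by simpa using h0 0)
  | succ n ih =>
    rw [Complex.Gamma_add_one _ (h0 _), Finset.prod_range_succ]
    push_cast
    rw [← add_assoc, ih]
    ring

/-- This is Euler's limit formula for Γ(s), divided by Γ(s). -/
theorem tendsto_factorial_div_Gamma {s : ℂ} (hs : 0 < s.re) :
    Tendsto (fun n : ℕ => (n : ℂ) ^ s * n.factorial / Complex.Gamma (s + n + 1)) atTop (𝓝 1) := by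
  have hG := Complex.Gamma_ne_zero_of_re_pos hs
  have h1 := (Complex.GammaSeq_tendsto_Gamma s).div_const (Complex.Gamma s)
  rw [div_self hG] at h1
  refine h1.congr fun n => ?_
  rw [Gamma_add_nat_add_one hs, Complex.GammaSeq, div_div]

theorem tendsto_gammaRatio_div_cpow_nat {x : ℂ} (hx : 0 < x.re) :
    Tendsto (fun n : ℕ => gammaRatio (x + 2 * (n + 1 : ℕ)) / (n : ℂ) ^ (1 / 2 : ℂ)) atTop (𝓝 1) := by
  have h1 := tendsto_factorial_div_Gamma (s := x / 2) (by simp; linarith)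
  have h2 := tendsto_factorial_div_Gamma (s := (x + 1) / 2) (by simp; linarith)
  have h3 := h1.div h2 one_ne_zero
  rw [div_one] at h3
  refine h3.congr' ?_
  filter_upwards [eventually_gt_atTop 0] with n hn
  have hn0 : (n : ℂ) ≠ 0 := by exact_mod_cast hn.ne'
  have e1 : (x + 2 * ((n + 1 : ℕ) : ℂ) + 1) / 2 = (x + 1) / 2 + n + 1 := by push_cast; ring
  have e2 : (x + 2 * ((n + 1 : ℕ) : ℂ)) / 2 = x / 2 + n + 1 := by push_cast; ring
  have e3 : (x + 1) / 2 = x / 2 + 1 / 2 := by ring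
  have g1 : Complex.Gamma ((x + 1) / 2 + n + 1) ≠ 0 :=
    Complex.Gamma_ne_zero_of_re_pos (by simp; positivity)
  have g2 : Complex.Gamma (x / 2 + n + 1) ≠ 0 :=
    Complex.Gamma_ne_zero_of_re_pos (by simp; positivity)
  have p1 : (n : ℂ) ^ (x / 2) ≠ 0 := cpow_ne_zero_of_ne_zero hn0 _
  have p2 : (n : ℂ) ^ (1 / 2 : ℂ) ≠ 0 := cpow_ne_zero_of_ne_zero hn0 _
  have p3 : (n.factorial : ℂ) ≠ 0 := by exact_mod_cast n.factorial_ne_zero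
  have e4 : (n : ℂ) ^ ((x + 1) / 2) = (n : ℂ) ^ (x / 2) * (n : ℂ) ^ (1 / 2 : ℂ) := by
    rw [e3, Complex.cpow_add _ _ hn0]
  simp only [Pi.div_apply]
  rw [gammaRatio, e1, e2, e4]
  field_simp

/-- The telescoping bound for the exponent -2 makes the constant uniform in z and N; the resulting
decay 1/‖z‖ is what controls the infinite product for the Gamma quotient. -/
theorem exists_sum_inv_sq_le : ∃ K : ℝ, 0 < K ∧ ∀ (z : ℂ), 1 ≤ z.re → ∀ N : ℕ,
    ∑ n ∈ Finset.range N, ‖z + 2 * n‖ ^ (-2 : ℝ) ≤ K / ‖z‖ := by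
  obtain ⟨K, hK, hKb⟩ := exists_rpow_le_telescope (show (-2 : ℝ) < -1 by norm_num)
  refine ⟨4 * K, by positivity, fun z hz N => ?_⟩
  have hzn : 1 ≤ ‖z‖ := by linarith [Complex.re_le_norm z]
  have h1 : ∑ n ∈ Finset.range N, ‖z + 2 * n‖ ^ (-2 : ℝ) ≤
      4 * K * ((‖z‖ + 2 * (0 : ℕ)) ^ (-1 : ℝ) - (‖z‖ + 2 * (N : ℕ)) ^ (-1 : ℝ)) := by
    rw [← Finset.sum_range_sub' (fun n : ℕ => (‖z‖ + 2 * n) ^ (-1 : ℝ)), Finset.mul_sum]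
    refine Finset.sum_le_sum fun n _ => ?_
    have hn : (0 : ℝ) ≤ n := n.cast_nonneg
    have h2 : ‖z + 2 * n‖ ^ (-2 : ℝ) ≤ ((‖z‖ + 2 * n) / 2) ^ (-2 : ℝ) :=
      Real.rpow_le_rpow_of_nonpos (by linarith)
        (norm_add_two_mul_ge (by linarith) n) (by norm_num)
    rw [Real.div_rpow (by linarith) (by norm_num), div_eq_mul_inv,
      ← Real.rpow_neg (by norm_num)] at h2
    have h3 := hKb (‖z‖ + 2 * n) (by linarith)
    have h4 : ‖z‖ + 2 * ((n + 1 : ℕ) : ℝ) = ‖z‖ + 2 * n + 2 := by push_cast; ring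
    rw [h4]
    norm_num at h2 h3 ⊢
    linarith
  refine h1.trans ?_
  rw [Real.rpow_neg_one, Real.rpow_neg_one]
  have h5 : 0 ≤ (‖z‖ + 2 * (N : ℝ))⁻¹ := by positivity
  simp only [Nat.cast_zero, mul_zero, add_zero]
  rw [div_eq_mul_inv]
  nlinarith

/-- Replaces Stirling's formula in a complex half-plane. The normalized quotient q satisfies q(x +
2) = (1 + ε(x)) q(x) with ε = O(|x|^{-2}). Along each sequence x + 2N, Euler's limit gives the same
value 2^{-1/2}, and the product of the factors 1 + ε differs from 1 by O(1/|x|), which makes the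
convergence uniform in Im x. -/
theorem tendsto_gammaRatio_div_cpow :
    ∃ c : ℂ, c ≠ 0 ∧ Tendsto (fun x => gammaRatio x / x ^ (1 / 2 : ℂ)) reTop (𝓝 c) := by
  set q : ℂ → ℂ := fun x => gammaRatio x / x ^ (1 / 2 : ℂ) with hq
  set q₀ : ℂ := ((2 : ℝ) : ℂ) ^ (1 / 2 : ℂ) with hq₀
  have hq₀0 : q₀ ≠ 0 := cpow_ne_zero_of_ne_zero (by norm_num) _
  have hpt : ∀ x : ℂ, 0 < x.re →
      Tendsto (fun n : ℕ => q (x + 2 * (n + 1 : ℕ))) atTop (𝓝 q₀⁻¹) := by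
    intro x hx
    have hnat : Tendsto (fun n : ℕ => (n : ℂ)) atTop reTop :=
      tendsto_comap_iff.mpr (by simpa [Function.comp_def] using tendsto_natCast_atTop_atTop)
    have h1 := (tendsto_cpow_affine_div two_pos (x + 2) (1 / 2)).comp hnat
    have h2 := (tendsto_gammaRatio_div_cpow_nat hx).div h1 hq₀0
    rw [← one_div q₀]
    refine h2.congr' ?_
    filter_upwards [eventually_gt_atTop 0] with n hn
    have hn0 : (n : ℂ) ≠ 0 := by exact_mod_cast hn.ne'
    have p2 : (n : ℂ) ^ (1 / 2 : ℂ) ≠ 0 := cpow_ne_zero_of_ne_zero hn0 _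
    have e : ((2 : ℝ) : ℂ) * (n : ℂ) + (x + 2) = x + 2 * ((n + 1 : ℕ) : ℂ) := by push_cast; ring
    simp only [Pi.div_apply, Function.comp_apply, hq]
    rw [e]
    field_simp
  set ε : ℂ → ℂ := fun x => q (x + 2) / q x - 1 with hε
  have hqne : ∀ x : ℂ, 0 < x.re → q x ≠ 0 := fun x hx =>
    div_ne_zero (gammaRatio_ne_zero hx) (cpow_ne_zero_of_ne_zero (by rintro rfl; simp at hx) _)
  have hεeq : ∀ x : ℂ, 0 < x.re →
      1 + ε x = ((x + 1) / x) * (((1 : ℝ) * x + 2) ^ (1 / 2 : ℂ) / x ^ (1 / 2 : ℂ))⁻¹ := by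
    intro x hx
    have hx0 : x ≠ 0 := by rintro rfl; simp at hx
    have hx2 : x + 2 ≠ 0 := by
      intro h
      have := congrArg Complex.re h
      simp at this
      linarith
    have := gammaRatio_ne_zero hx
    have p1 := cpow_ne_zero_of_ne_zero hx0 (1 / 2)
    have p2 := cpow_ne_zero_of_ne_zero hx2 (1 / 2)
    simp only [hε, hq, gammaRatio_add_two hx, Complex.ofReal_one, one_mul]
    field_simp
    ring
  -- Squaring removes the square roots: (1 + ε)² = (x + 1)²/(x(x + 2)) = 1 + 1/(x(x + 2)). Since 2 +
  -- ε stays away from 0, the quadratic decay of ε follows.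
  have hεsq : ∀ x : ℂ, 0 < x.re → ε x * (2 + ε x) = 1 / (x * (x + 2)) := by
    intro x hx
    have hx0 : x ≠ 0 := by rintro rfl; simp at hx
    have hx2 : x + 2 ≠ 0 := by
      intro h
      have := congrArg Complex.re h
      simp at this
      linarith
    have h1 : (1 + ε x) ^ 2 = (x + 1) ^ 2 / (x * (x + 2)) := by
      have hs : ∀ y : ℂ, (y ^ (1 / 2 : ℂ)) ^ 2 = y := fun y => by
        rw [← Complex.cpow_nat_mul]; simp
      rw [hεeq x hx, mul_pow, inv_pow, div_pow, div_pow, hs, hs, Complex.ofReal_one, one_mul]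
      field_simp
    have h2 : ε x * (2 + ε x) = (1 + ε x) ^ 2 - 1 := by ring
    rw [h2, h1]
    field_simp
    ring
  have hεlim : Tendsto ε reTop (𝓝 0) := by
    have h1 := (tendsto_affine_div_reTop 1 1).mul
      ((tendsto_cpow_affine_div one_pos 2 (1 / 2)).inv₀ (by simp))
    have h2 := h1.sub_const 1
    simp only [Complex.ofReal_one, Complex.one_cpow, inv_one, mul_one, sub_self] at h2
    refine h2.congr' ?_
    filter_upwards [eventually_re_ge 1] with x hx
    have := hεeq x (by linarith)
    simp only [Complex.ofReal_one] at this
    simp only [one_mul] at this ⊢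
    rw [← this]
    ring
  have hεbound : ∀ᶠ x in reTop, ‖ε x‖ ≤ ‖x‖ ^ (-2 : ℝ) := by
    have h1 : ∀ᶠ x in reTop, ‖ε x‖ < 1 := by
      have := (Metric.tendsto_nhds.mp hεlim) 1 one_pos
      simpa using this
    filter_upwards [h1, eventually_re_ge 1] with x h1 hx
    have h2 := congrArg norm (hεsq x (by linarith))
    rw [norm_mul, norm_div, norm_one, norm_mul] at h2
    have h3 : 1 ≤ ‖2 + ε x‖ := by
      have := norm_sub_le (2 + ε x) (ε x)
      simp at this
      linarith
    have hxn : 1 ≤ ‖x‖ := by linarith [Complex.re_le_norm x]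
    have h4 : ‖x‖ ≤ ‖x + 2‖ := by
      have := norm_add_two_mul_ge (z := x) (by linarith) 1
      rw [Complex.norm_def, Complex.norm_def]
      apply Real.sqrt_le_sqrt
      simp only [Complex.normSq_apply, Complex.add_re, Complex.add_im, Complex.re_ofNat,
        Complex.im_ofNat]
      nlinarith
    have h5 : 1 / (‖x‖ * ‖x + 2‖) ≤ ‖x‖ ^ (-2 : ℝ) := by
      rw [Real.rpow_neg (by linarith), Real.rpow_two, ← one_div]
      apply one_div_le_one_div_of_le (by positivity)
      nlinarith
    have h6 : ‖ε x‖ * 1 ≤ ‖ε x‖ * ‖2 + ε x‖ := by gcongr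
    linarith
  obtain ⟨x₀, hx₀⟩ := eventually_reTop.mp hεbound
  obtain ⟨K, hK, hKsum⟩ := exists_sum_inv_sq_le
  refine ⟨q₀⁻¹, inv_ne_zero hq₀0, ?_⟩
  set δ : ℂ → ℝ := fun x => Real.exp (K / ‖x‖) - 1 with hδ
  have hδlim : Tendsto δ reTop (𝓝 0) := by
    have h1 : Tendsto (fun x : ℂ => K / ‖x‖) reTop (𝓝 0) :=
      tendsto_norm_reTop.const_div_atTop K
    have h2 := ((Real.continuous_exp.tendsto 0).comp h1).sub_const 1
    simpa using h2
  have hmain : ∀ x : ℂ, max x₀ 1 ≤ x.re → ‖q₀⁻¹ - q x‖ ≤ ‖q x‖ * δ x := by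
    intro x hx
    have hx1 : 1 ≤ x.re := (le_max_right _ _).trans hx
    have hprod : ∀ N : ℕ, q (x + 2 * N) = q x * ∏ n ∈ Finset.range N, (1 + ε (x + 2 * n)) := by
      intro N
      induction N with
      | zero => simp
      | succ N ih =>
        rw [Finset.prod_range_succ, ← mul_assoc, ← ih]
        have e : x + 2 * ((N + 1 : ℕ) : ℂ) = x + 2 * N + 2 := by push_cast; ring
        have := hqne (x + 2 * N) (by simp; positivity)
        rw [e]
        simp only [hε]
        field_simp
        ring
    have hbd : ∀ N : ℕ, ‖q (x + 2 * N) - q x‖ ≤ ‖q x‖ * δ x := by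
      intro N
      have h1 : q (x + 2 * N) - q x =
          q x * (∏ n ∈ Finset.range N, (1 + ε (x + 2 * n)) - 1) := by rw [hprod N]; ring
      rw [h1, norm_mul]
      refine mul_le_mul_of_nonneg_left ?_ (norm_nonneg _)
      refine (Finset.norm_prod_one_add_sub_one_le _ _).trans ?_
      simp only [hδ]
      gcongr
      refine le_trans (Finset.sum_le_sum fun n _ => ?_) (hKsum x hx1 N)
      refine hx₀ _ ?_
      have := (le_max_left x₀ 1).trans hx
      have hn : (0 : ℝ) ≤ n := n.cast_nonneg
      simp
      linarith
    have h2 := ((hpt x (by linarith)).sub_const (q x)).norm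
    exact le_of_tendsto' h2 fun n => hbd (n + 1)
  rw [tendsto_iff_norm_sub_tendsto_zero]
  have h3 : Tendsto (fun x => 2 * ‖q₀⁻¹‖ * δ x) reTop (𝓝 0) := by
    simpa using hδlim.const_mul (2 * ‖q₀⁻¹‖)
  refine squeeze_zero' (Eventually.of_forall fun _ => norm_nonneg _) ?_ h3
  have h4 : ∀ᶠ x in reTop, δ x < 1 / 2 := hδlim.eventually_lt_const (by norm_num)
  filter_upwards [h4, eventually_re_ge (max x₀ 1)] with x h4 hx
  have h5 := hmain x hx
  have h6 : 0 ≤ δ x := by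
    have : 0 ≤ K / ‖x‖ := by positivity
    have := Real.add_one_le_exp (K / ‖x‖)
    simp only [hδ]; linarith
  -- As δ x < 1/2, q differs from its limit by at most ‖q x‖/2; this removes q from the right-hand
  -- side of the error bound.
  have h7 : ‖q x‖ ≤ 2 * ‖q₀⁻¹‖ := by
    have := norm_sub_norm_le (q x) q₀⁻¹
    rw [norm_sub_rev] at this
    nlinarith [norm_nonneg (q x)]
  rw [norm_sub_rev]
  exact h5.trans (by gcongr)

theorem IsShiftFactor.prod_range (k : ℕ) (ρ : ℕ → ℂ → ℂ) (a : ℝ)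
    (h : ∀ j < k, IsShiftFactor (ρ j) a) :
    IsShiftFactor (fun z => ∏ j ∈ Finset.range k, ρ j z) (k * a) := by
  induction k with
  | zero => simpa using isShiftFactor_one
  | succ k ih =>
    have h1 := (ih fun j hj => h j (by omega)).mul (h k (by omega))
    simp only [Finset.prod_range_succ]
    convert h1 using 1
    push_cast; ring

/-- The shift z ↦ z + 2 moves kz + c by 2k, that is, by k steps of length 2. Each step contributes a
factor (y + 1)/y of shift exponent 1/(2k), and these add up to 1/2. -/
theorem isHypergeometric_gammaRatio {k : ℕ} (hk : 0 < k) (c : ℂ) :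
    IsHypergeometric (fun z => gammaRatio ((k : ℂ) * z + c)) (1 / 2) where
  asymptotic := by
    obtain ⟨d, hd, h1⟩ := tendsto_gammaRatio_div_cpow
    have hk' : (0 : ℝ) < k := by exact_mod_cast hk
    have h2 := h1.comp (tendsto_affine_reTop hk' c)
    have h3 := tendsto_cpow_affine_div hk' c (1 / 2)
    refine ⟨d * ((k : ℝ) : ℂ) ^ (1 / 2 : ℂ), mul_ne_zero hd
      (cpow_ne_zero_of_ne_zero (by exact_mod_cast hk.ne') _), (h2.mul h3).congr' ?_⟩
    filter_upwards [(tendsto_affine_reTop hk' c).eventually eventually_ne_zero_reTop] with z hz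
    have p1 := cpow_ne_zero_of_ne_zero hz (1 / 2)
    simp only [Function.comp_apply, Complex.ofReal_natCast] at p1 ⊢
    push_cast
    field_simp
  shift := by
    have hk0 : (k : ℂ) ≠ 0 := by exact_mod_cast hk.ne'
    have hk' : (0 : ℝ) < k := by exact_mod_cast hk
    have h1 := IsShiftFactor.prod_range k
      (fun j z => ((k : ℂ) * z + (c + 2 * j) + 1) / ((k : ℂ) * z + (c + 2 * j))) (1 / (2 * k))
      (fun j _ => isShiftFactor_affine hk0 _ 1 (by push_cast; field_simp))
    have e : (k : ℝ) * (1 / (2 * k)) = 1 / 2 := by field_simp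
    rw [e] at h1
    refine ⟨_, h1, ?_⟩
    filter_upwards [(tendsto_affine_reTop hk' c).eventually (eventually_re_ge 1)] with z hz
    simp only [Complex.ofReal_natCast] at hz
    have h2 := gammaRatio_add_two_mul (x := (k : ℂ) * z + c) (by linarith) k
    have e2 : (k : ℂ) * (z + 2) + c = (k : ℂ) * z + c + 2 * k := by ring
    rw [e2, h2]
    simp only [add_assoc]

end WengZeta

/-! ### Dirichlet coefficients of quotients of zeta values -/

namespace WengZeta
open Filter Topology Polynomial
open ArithmeticFunction (IsMultiplicative moebius)

/-- The arithmetic function supported on `k`-th powers with value `f n` at `n ^ k`. -/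
noncomputable def powLift (k : ℕ) (f : ArithmeticFunction ℂ) : ArithmeticFunction ℂ where
  toFun N := open Classical in if h : N ≠ 0 ∧ ∃ n, n ^ k = N then f h.2.choose else 0
  map_zero' := by simp

theorem powLift_pow {k : ℕ} (hk : k ≠ 0) (f : ArithmeticFunction ℂ) (n : ℕ) :
    powLift k f (n ^ k) = f n := by
  rcases eq_or_ne n 0 with rfl | hn
  · simp [hk]
  · have h : n ^ k ≠ 0 ∧ ∃ m, m ^ k = n ^ k := ⟨pow_ne_zero _ hn, n, rfl⟩
    change (if h : n ^ k ≠ 0 ∧ ∃ m, m ^ k = n ^ k then f h.2.choose else 0) = f n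
    rw [dif_pos h, Nat.pow_left_injective hk h.2.choose_spec]

theorem powLift_of_not {k : ℕ} (f : ArithmeticFunction ℂ) {N : ℕ} (h : ¬ ∃ n, n ^ k = N) :
    powLift k f N = 0 :=
  dif_neg fun h' => h h'.2

/-- If a product of coprime integers is a k-th power, then so is each factor. -/
theorem isMultiplicative_powLift {k : ℕ} (hk : k ≠ 0) {f : ArithmeticFunction ℂ}
    (hf : f.IsMultiplicative) : (powLift k f).IsMultiplicative := by
  refine ⟨by simpa [hf.1] using powLift_pow hk f 1, ?_⟩
  intro m n hmn
  by_cases h : ∃ c, c ^ k = m * n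
  · obtain ⟨c, hc⟩ := h
    have hu : ∀ a b : ℕ, a.Coprime b → IsUnit (gcd a b) := fun a b h => by
      rw [Nat.isUnit_iff]; exact h
    obtain ⟨x, rfl⟩ := exists_eq_pow_of_mul_eq_pow (hu _ _ hmn) hc.symm
    obtain ⟨y, rfl⟩ := exists_eq_pow_of_mul_eq_pow (hu _ _ hmn.symm) ((mul_comm _ _).trans hc.symm)
    rw [← mul_pow, powLift_pow hk, powLift_pow hk, powLift_pow hk]
    refine hf.2 ?_
    rwa [Nat.coprime_pow_left_iff (Nat.pos_of_ne_zero hk),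
      Nat.coprime_pow_right_iff (Nat.pos_of_ne_zero hk)] at hmn
  · rw [powLift_of_not f h]
    by_cases hm : ∃ x, x ^ k = m
    · by_cases hn : ∃ y, y ^ k = n
      · obtain ⟨x, rfl⟩ := hm
        obtain ⟨y, rfl⟩ := hn
        exact absurd ⟨x * y, mul_pow _ _ _⟩ h
      · rw [powLift_of_not f hn, mul_zero]
    · rw [powLift_of_not f hm, zero_mul]

theorem natCast_pow_cpow (n k : ℕ) (s : ℂ) : ((n ^ k : ℕ) : ℂ) ^ s = (n : ℂ) ^ ((k : ℂ) * s) := by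
  rw [Complex.cpow_nat_mul]
  induction k with
  | zero => simp
  | succ k ih =>
    rw [pow_succ, Nat.cast_mul, Complex.natCast_mul_natCast_cpow, ih, pow_succ]

/-- Since n^{-ks} = (n^k)^{-s}, a Dirichlet series in ks is one in s supported on k-th powers. -/
theorem LSeriesHasSum_powLift {k : ℕ} (hk : k ≠ 0) {f : ArithmeticFunction ℂ} {s a : ℂ}
    (h : LSeriesHasSum (fun n => f n) ((k : ℂ) * s) a) :
    LSeriesHasSum (fun n => powLift k f n) s a := by
  have hinj : Function.Injective fun n : ℕ => n ^ k := Nat.pow_left_injective hk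
  refine (hinj.hasSum_iff ?_).mp ?_
  · intro N hN
    have : powLift k f N = 0 := powLift_of_not f hN
    rcases eq_or_ne N 0 with rfl | h0
    · simp
    · simp [LSeries.term_of_ne_zero h0, this]
  · refine HasSum.congr_fun h fun n => ?_
    rcases eq_or_ne n 0 with rfl | h0
    · simp [hk]
    · simp only [Function.comp_apply]
      rw [LSeries.term_of_ne_zero h0, LSeries.term_of_ne_zero (pow_ne_zero k h0),
        powLift_pow hk, natCast_pow_cpow]

/-- The arithmetic function whose `L`-series is `ζ(s - h + 1) / ζ(s - h)`, for `1 ≤ h`. -/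
noncomputable def zetaQuotient (h : ℕ) : ArithmeticFunction ℂ :=
  (ArithmeticFunction.pow (h - 1) : ArithmeticFunction ℂ) *
    ((moebius : ArithmeticFunction ℂ).pmul (ArithmeticFunction.pow h : ArithmeticFunction ℂ))

theorem isMultiplicative_zetaQuotient (h : ℕ) : (zetaQuotient h).IsMultiplicative :=
  (ArithmeticFunction.isMultiplicative_pow.natCast).mul
    ((ArithmeticFunction.isMultiplicative_moebius.intCast).pmul
      ArithmeticFunction.isMultiplicative_pow.natCast)

theorem zetaQuotient_prime {h q : ℕ} (hh : 1 ≤ h) (hq : q.Prime) :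
    zetaQuotient h q = ((q : ℝ) ^ (h - 1) - (q : ℝ) ^ h : ℝ) := by
  rw [zetaQuotient, ArithmeticFunction.mul_apply,
    Nat.sum_divisorsAntidiagonal (f := fun i j =>
      (ArithmeticFunction.pow (h - 1) : ArithmeticFunction ℂ) i *
      ((moebius : ArithmeticFunction ℂ).pmul (ArithmeticFunction.pow h : ArithmeticFunction ℂ)) j),
    hq.sum_divisors]
  have hq0 := hq.ne_zero
  have h0 : h ≠ 0 := by omega
  simp [ArithmeticFunction.pow_apply, hq0, h0, Nat.div_self hq.pos,
    ArithmeticFunction.moebius_apply_prime hq]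
  ring

theorem LSeriesHasSum_pow {k : ℕ} {s : ℂ} (hs : k + 1 < s.re) :
    LSeriesHasSum (fun n => (ArithmeticFunction.pow k : ArithmeticFunction ℂ) n) s
      (riemannZeta (s - k)) := by
  have h1 := LSeriesHasSum_one (s := s - k) (by simp; linarith)
  refine HasSum.congr_fun h1 fun n => ?_
  rcases eq_or_ne n 0 with rfl | h0
  · simp
  · have hn : (n : ℂ) ≠ 0 := by exact_mod_cast h0
    rw [LSeries.term_of_ne_zero h0, LSeries.term_of_ne_zero h0, Complex.cpow_sub _ _ hn,
      Complex.cpow_natCast]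
    simp [ArithmeticFunction.pow_apply, h0]

theorem LSeriesHasSum_moebius_pow {k : ℕ} {s : ℂ} (hs : k + 1 < s.re) :
    LSeriesHasSum (fun n => ((moebius : ArithmeticFunction ℂ).pmul
      (ArithmeticFunction.pow k : ArithmeticFunction ℂ)) n) s (riemannZeta (s - k))⁻¹ := by
  have hs' : 1 < (s - k).re := by simp; linarith
  have h1 := (ArithmeticFunction.LSeriesSummable_moebius_iff.mpr hs').LSeriesHasSum
  have h2 := LSeries_one_mul_Lseries_moebius hs'
  rw [LSeries_one_eq_riemannZeta hs'] at h2
  rw [eq_inv_of_mul_eq_one_right h2] at h1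
  refine HasSum.congr_fun h1 fun n => ?_
  rcases eq_or_ne n 0 with rfl | h0
  · simp
  · have hn : (n : ℂ) ≠ 0 := by exact_mod_cast h0
    rw [LSeries.term_of_ne_zero h0, LSeries.term_of_ne_zero h0, Complex.cpow_sub _ _ hn,
      Complex.cpow_natCast]
    simp [ArithmeticFunction.pow_apply, h0, div_div_eq_mul_div]

theorem LSeriesHasSum_zetaQuotient {h : ℕ} (hh : 1 ≤ h) {s : ℂ} (hs : h + 1 < s.re) :
    LSeriesHasSum (fun n => zetaQuotient h n) s
      (riemannZeta (s - h + 1) / riemannZeta (s - h)) := by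
  have e : s - ((h - 1 : ℕ) : ℂ) = s - h + 1 := by push_cast [hh]; ring
  have h1 := LSeriesHasSum_pow (k := h - 1) (s := s) (by push_cast [hh]; linarith)
  rw [e] at h1
  exact ArithmeticFunction.LSeriesHasSum_mul h1 (LSeriesHasSum_moebius_pow hs)

theorem mul_apply_prime_pow {q : ℕ} (hq : q.Prime) (f g : ArithmeticFunction ℂ) (k : ℕ) :
    (f * g) (q ^ k) = ∑ j ∈ Finset.range (k + 1), f (q ^ j) * g (q ^ (k - j)) := by
  rw [ArithmeticFunction.mul_apply, Nat.sum_divisorsAntidiagonal (f := fun i j => f i * g j),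
    Nat.sum_divisors_prime_pow hq]
  refine Finset.sum_congr rfl fun j hj => ?_
  rw [Nat.pow_div (by simpa [Nat.lt_succ_iff] using hj) hq.pos]

/-- Products of functions vanishing at `q, …, q^(k-1)` are additive at `q^k`. -/
theorem prod_apply_prime_pow {κ : Type*} {q k : ℕ} (hq : q.Prime) (hk : k ≠ 0) (s : Finset κ)
    (f : κ → ArithmeticFunction ℂ) (h1 : ∀ i ∈ s, f i 1 = 1)
    (h0 : ∀ i ∈ s, ∀ j, 0 < j → j < k → f i (q ^ j) = 0) :
    (∏ i ∈ s, f i) 1 = 1 ∧ (∀ j, 0 < j → j < k → (∏ i ∈ s, f i) (q ^ j) = 0) ∧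
      (∏ i ∈ s, f i) (q ^ k) = ∑ i ∈ s, f i (q ^ k) := by
  classical
  induction s using Finset.induction_on with
  | empty =>
    have hne : ∀ j, j ≠ 0 → q ^ j ≠ 1 := fun j hj => (Nat.one_lt_pow hj hq.one_lt).ne'
    refine ⟨by simp, fun j hj _ => ?_, ?_⟩
    · simp [ArithmeticFunction.one_apply_ne (hne j hj.ne')]
    · simp [ArithmeticFunction.one_apply_ne (hne k hk)]
  | insert i s hi ih =>
    obtain ⟨a1, a2, a3⟩ := ih (fun j hj => h1 j (Finset.mem_insert_of_mem hj))
      (fun j hj => h0 j (Finset.mem_insert_of_mem hj))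
    have b1 := h1 i (Finset.mem_insert_self _ _)
    have b2 := h0 i (Finset.mem_insert_self _ _)
    rw [Finset.prod_insert hi, Finset.sum_insert hi]
    refine ⟨?_, fun j hj hjk => ?_, ?_⟩
    · simp [a1, b1]
    · rw [mul_apply_prime_pow hq]
      refine Finset.sum_eq_zero fun l hl => ?_
      rw [Finset.mem_range] at hl
      rcases Nat.eq_zero_or_pos l with rfl | hl0
      · rw [Nat.sub_zero, a2 j hj hjk, mul_zero]
      · rw [b2 l hl0 (by omega), zero_mul]
    · rw [mul_apply_prime_pow hq, Finset.sum_range_succ,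
        Finset.sum_eq_single_of_mem 0 (by simp; omega)]
      · simp [a1, b1, a3, add_comm]
      · intro l hl hl0
        rw [Finset.mem_range] at hl
        rw [b2 l (by omega) hl, zero_mul]

theorem powLift_prime_pow_of_lt {q k j : ℕ} (hq : q.Prime) (f : ArithmeticFunction ℂ)
    (hj : 0 < j) (hjk : j < k) : powLift k f (q ^ j) = 0 := by
  refine powLift_of_not f ?_
  rintro ⟨n, hn⟩
  obtain ⟨i, -, rfl⟩ := (Nat.dvd_prime_pow hq).mp (hn ▸ dvd_pow_self n (by omega : k ≠ 0))
  rw [← pow_mul] at hn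
  have := Nat.pow_right_injective hq.two_le hn
  rcases Nat.eq_zero_or_pos i with rfl | hi
  · omega
  · nlinarith

/-- A nonempty product of quotients `ζ(kz - h + 1) / ζ(kz - h)` has a nonzero coefficient at some
positive power of `q`, with an exponent independent of the prime `q`. -/
theorem exists_prod_zetaQuotient_ne_zero {κ : Type*} (s : Finset κ) (hs : s.Nonempty)
    (k h : κ → ℕ) (hk : ∀ i ∈ s, 1 ≤ k i) (hh : ∀ i ∈ s, 1 ≤ h i) :
    ∃ m : ℕ, 0 < m ∧ ∀ q : ℕ, q.Prime →
      (∏ i ∈ s, powLift (k i) (zetaQuotient (h i))) (q ^ m) ≠ 0 := by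
  -- The exponent is the smallest level. At that power of q only the factors of minimal level
  -- contribute, each adding q^{h-1} - q^h < 0, so no cancellation is possible.
  obtain ⟨i₀, hi₀, hmin⟩ := s.exists_min_image k hs
  refine ⟨k i₀, hk _ hi₀, fun q hq => ?_⟩
  have hk0 := hk _ hi₀
  rw [(prod_apply_prime_pow hq (by omega) s _ (fun i hi => ?_) (fun i hi j hj hjk => ?_)).2.2]
  · have hval : ∀ i ∈ s, ∃ r : ℝ, r ≤ 0 ∧ (k i = k i₀ → r < 0) ∧
        powLift (k i) (zetaQuotient (h i)) (q ^ k i₀) = r := by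
      intro i hi
      rcases (hmin i hi).lt_or_eq with h1 | h1
      · exact ⟨0, le_rfl, fun h2 => by omega, by
          simpa using powLift_prime_pow_of_lt hq _ hk0 h1⟩
      · have hlt : (q : ℝ) ^ (h i - 1) < (q : ℝ) ^ (h i) :=
          pow_lt_pow_right₀ (by exact_mod_cast hq.one_lt) (by have := hh i hi; omega)
        refine ⟨(q : ℝ) ^ (h i - 1) - (q : ℝ) ^ (h i), by linarith, fun _ => by linarith, ?_⟩
        rw [h1, powLift_pow (by have := hk i hi; omega), zetaQuotient_prime (hh i hi) hq]
    choose! r hr0 hr1 hr2 using hval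
    rw [Finset.sum_congr rfl hr2, ← Complex.ofReal_sum, Complex.ofReal_ne_zero]
    exact (Finset.sum_neg' hr0 ⟨i₀, hi₀, hr1 i₀ hi₀ rfl⟩).ne
  · exact (isMultiplicative_powLift (by have := hk i hi; omega) (isMultiplicative_zetaQuotient _)).1
  · exact powLift_prime_pow_of_lt hq _ hj (hjk.trans_le (hmin i hi))

theorem isMultiplicative_prod {κ : Type*} (s : Finset κ) (f : κ → ArithmeticFunction ℂ)
    (h : ∀ i ∈ s, (f i).IsMultiplicative) : (∏ i ∈ s, f i).IsMultiplicative :=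
  Finset.prod_induction f IsMultiplicative (fun _ _ ha hb => ha.mul hb)
    ArithmeticFunction.isMultiplicative_one h

theorem LSeriesHasSum_prod {κ : Type*} (s : Finset κ) (f : κ → ArithmeticFunction ℂ)
    (z : ℂ) (a : κ → ℂ) (h : ∀ i ∈ s, LSeriesHasSum (fun n => f i n) z (a i)) :
    LSeriesHasSum (fun n => (∏ i ∈ s, f i) n) z (∏ i ∈ s, a i) := by
  classical
  induction s using Finset.induction_on with
  | empty =>
    simp only [Finset.prod_empty]
    rw [ArithmeticFunction.one_eq_delta]
    have h1 : HasSum (fun n : ℕ => if n = 1 then (1 : ℂ) else 0) 1 := hasSum_ite_eq 1 1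
    exact HasSum.congr_fun h1 fun n => LSeries.term_delta z n
  | insert i s hi ih =>
    rw [Finset.prod_insert hi, Finset.prod_insert hi]
    exact ArithmeticFunction.LSeriesHasSum_mul (h i (Finset.mem_insert_self _ _))
      (ih fun j hj => h j (Finset.mem_insert_of_mem hj))

end WengZeta

/-! ### Zero-free regions for Dirichlet series with hypergeometric coefficients -/

namespace WengZeta
open Filter Topology Polynomial
open ArithmeticFunction (IsMultiplicative)

/-- The tail of an `L`-series after the term of index `n` is `O((n+1)^{-Re z})`. -/
theorem exists_norm_LSeries_sub_le {a : ℕ → ℂ} {σ : ℝ} (h : LSeriesSummable a σ) (n : ℕ) :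
    ∃ C : ℝ, 0 ≤ C ∧ ∀ z : ℂ, σ ≤ z.re →
      ‖LSeries a z - ∑ m ∈ Finset.range (n + 1), LSeries.term a z m‖ ≤
        C * ((n : ℝ) + 1) ^ (-z.re) := by
  have hn : (0 : ℝ) < (n : ℝ) + 1 := by positivity
  have hsn : Summable fun m => ‖LSeries.term a σ (m + (n + 1))‖ :=
    (summable_nat_add_iff (f := fun m => ‖LSeries.term a σ m‖) (n + 1)).mpr h.norm
  refine ⟨((n : ℝ) + 1) ^ σ * ∑' m, ‖LSeries.term a σ (m + (n + 1))‖,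
    mul_nonneg (by positivity) (tsum_nonneg fun _ => norm_nonneg _), fun z hz => ?_⟩
  have hz' : LSeriesSummable a z := h.of_re_le_re (by simpa using hz)
  have h1 : ∑ m ∈ Finset.range (n + 1), LSeries.term a z m +
      ∑' m, LSeries.term a z (m + (n + 1)) = LSeries a z :=
    Summable.sum_add_tsum_nat_add (f := LSeries.term a z) (n + 1) hz'
  have h2 : LSeries a z - ∑ m ∈ Finset.range (n + 1), LSeries.term a z m =
      ∑' m, LSeries.term a z (m + (n + 1)) := by
    rw [← h1, add_sub_cancel_left]
  rw [h2]
  have hterm : ∀ m : ℕ, ‖LSeries.term a z (m + (n + 1))‖ ≤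
      ((n : ℝ) + 1) ^ (σ - z.re) * ‖LSeries.term a σ (m + (n + 1))‖ := by
    intro m
    have hm0 : m + (n + 1) ≠ 0 := by omega
    have hmp : (0 : ℝ) < ((m + (n + 1) : ℕ) : ℝ) := by positivity
    rw [LSeries.norm_term_eq, LSeries.norm_term_eq, if_neg hm0, if_neg hm0, Complex.ofReal_re]
    -- Split off m^{-σ}, which is summable against the coefficients; the other factor m^{σ - Re z}
    -- has a nonpositive exponent and is largest at the first index n + 1.
    have e1 : (((m + (n + 1) : ℕ) : ℝ) ^ z.re)⁻¹ =
        ((m + (n + 1) : ℕ) : ℝ) ^ (σ - z.re) * (((m + (n + 1) : ℕ) : ℝ) ^ σ)⁻¹ := by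
      rw [← Real.rpow_neg hmp.le, ← Real.rpow_neg hmp.le, ← Real.rpow_add hmp]
      ring_nf
    rw [div_eq_mul_inv, e1, div_eq_mul_inv]
    have e2 : ((m + (n + 1) : ℕ) : ℝ) ^ (σ - z.re) ≤ ((n : ℝ) + 1) ^ (σ - z.re) :=
      Real.rpow_le_rpow_of_nonpos hn (by push_cast; linarith [(m.cast_nonneg : (0 : ℝ) ≤ m)])
        (by linarith)
    have e3 : 0 ≤ ‖a (m + (n + 1))‖ * (((m + (n + 1) : ℕ) : ℝ) ^ σ)⁻¹ := by positivity
    nlinarith [mul_le_mul_of_nonneg_right e2 e3]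
  have hsz : Summable fun m => ‖LSeries.term a z (m + (n + 1))‖ :=
    (summable_nat_add_iff (f := fun m => ‖LSeries.term a z m‖) (n + 1)).mpr hz'.norm
  refine (norm_tsum_le_tsum_norm hsz).trans
    ((hsz.tsum_le_tsum hterm (hsn.mul_left _)).trans_eq ?_)
  rw [tsum_mul_left, sub_eq_add_neg, Real.rpow_add hn]
  ring

theorem exists_norm_le_of_tendsto_div_cpow {f : ℂ → ℂ} {e : ℝ} {c : ℂ}
    (h : Tendsto (fun z => f z / z ^ (e : ℂ)) reTop (𝓝 c)) :
    ∀ᶠ z in reTop, ‖f z‖ ≤ (‖c‖ + 1) * ‖z‖ ^ e := by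
  have h1 := h.norm.eventually_lt_const (show ‖c‖ < ‖c‖ + 1 by linarith)
  filter_upwards [h1, eventually_ne_zero_reTop] with z h1 hz
  rw [norm_div, Complex.norm_cpow_real, div_lt_iff₀ (Real.rpow_pos_of_pos (norm_pos_iff.mpr hz) _)]
    at h1
  exact h1.le

theorem eventually_le_norm_of_tendsto_div_cpow {f : ℂ → ℂ} {e : ℝ} {c : ℂ} (hc : c ≠ 0)
    (h : Tendsto (fun z => f z / z ^ (e : ℂ)) reTop (𝓝 c)) :
    ∀ᶠ z in reTop, ‖c‖ / 2 * ‖z‖ ^ e ≤ ‖f z‖ := by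
  have hc' := norm_pos_iff.mpr hc
  have h1 := h.norm.eventually_const_lt (show ‖c‖ / 2 < ‖c‖ by linarith)
  filter_upwards [h1, eventually_ne_zero_reTop] with z h1 hz
  rw [norm_div, Complex.norm_cpow_real, lt_div_iff₀ (Real.rpow_pos_of_pos (norm_pos_iff.mpr hz) _)]
    at h1
  exact h1.le

/-- Linear independence: multiplicative functions which are nonzero at some power of every prime
can be separated from the identity of Dirichlet convolution. -/
theorem eventually_sum_eq_zero_of_forall_coeff {κ : Type*} [DecidableEq κ] (W W₀ : Finset κ)
    (hW₀ : W₀ ⊆ W) (V : κ → ℂ → ℂ) (a : κ → ArithmeticFunction ℂ)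
    (ha : ∀ w ∈ W, (a w).IsMultiplicative) (ha₀ : ∀ w ∈ W₀, a w = 1)
    (ha₁ : ∀ w ∈ W, w ∉ W₀ → ∃ m : ℕ, 0 < m ∧ ∀ q : ℕ, q.Prime → a w (q ^ m) ≠ 0)
    (hG : ∀ n, ∀ᶠ z in reTop, ∑ w ∈ W, a w n * V w z = 0) :
    ∀ᶠ z in reTop, ∑ w ∈ W₀, V w z = 0 := by
  classical
  choose! m hm0 hm using ha₁
  -- Distinct primes for distinct w make the integers N w = q_w^{m_w} pairwise coprime, so that
  -- every a w is multiplicative on their products.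
  obtain ⟨q, hqinj, hqp⟩ : ∃ q : κ → ℕ, (∀ v ∈ W, ∀ w ∈ W, q v = q w → v = w) ∧
      ∀ v, (q v).Prime := by
    refine ⟨fun v => if h : v ∈ W then Nat.nth Nat.Prime (W.equivFin ⟨v, h⟩) else 2, ?_, ?_⟩
    · intro v hv w hw h
      simp only [hv, hw, dif_pos] at h
      have h1 := Nat.nth_injective Nat.infinite_setOfPred_prime h
      have h2 := W.equivFin.injective (Fin.ext h1)
      exact congrArg Subtype.val h2
    · intro v
      by_cases h : v ∈ W
      · simp only [h, dif_pos]
        exact Nat.prime_nth_prime _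
      · simp only [h, dif_neg, not_false_eq_true]
        exact Nat.prime_two
  set W₁ := W \ W₀ with hW₁
  set N : κ → ℕ := fun w => q w ^ m w with hN
  have hN1 : ∀ w ∈ W₁, N w ≠ 1 := fun w hw =>
    (Nat.one_lt_pow (hm0 w (Finset.mem_sdiff.mp hw).1 (Finset.mem_sdiff.mp hw).2).ne'
      (hqp w).one_lt).ne'
  have haN : ∀ w ∈ W₁, a w (N w) ≠ 0 := fun w hw =>
    hm w (Finset.mem_sdiff.mp hw).1 (Finset.mem_sdiff.mp hw).2 _ (hqp w)
  have hcop : ∀ t ⊆ W₁, (t : Set κ).Pairwise (Function.onFun Nat.Coprime N) := by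
    intro t ht v hv w hw hvw
    refine Nat.Coprime.pow _ _ ((Nat.coprime_primes (hqp v) (hqp w)).mpr fun h => hvw ?_)
    exact hqinj v (Finset.mem_sdiff.mp (ht hv)).1 w (Finset.mem_sdiff.mp (ht hw)).1 h
  have hG' : ∀ᶠ z in reTop, ∀ t ∈ W₁.powerset, ∑ w ∈ W, a w (∏ v ∈ t, N v) * V w z = 0 := by
    rw [eventually_all_finset]
    exact fun t _ => hG _
  filter_upwards [hG'] with z hz
  -- The product ∏_v (1 - a_w(N_v)/a_v(N_v)) over W₁ is 0 for w in W₁, by the factor v = w, and 1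
  -- for w in W₀. Expanded, it is a combination, with weights independent of w, of values of a w at
  -- integers, so summing it against V w gives zero.
  have hexp : ∀ w ∈ W, ∏ v ∈ W₁, (1 + -(a v (N v))⁻¹ * a w (N v)) =
      ∑ t ∈ W₁.powerset, (∏ v ∈ t, -(a v (N v))⁻¹) * a w (∏ v ∈ t, N v) := by
    intro w hw
    rw [Finset.prod_one_add]
    refine Finset.sum_congr rfl fun t ht => ?_
    rw [(ha w hw).map_prod N t (hcop t (Finset.mem_powerset.mp ht)), Finset.prod_mul_distrib]
  have hsum : ∑ w ∈ W, (∏ v ∈ W₁, (1 + -(a v (N v))⁻¹ * a w (N v))) * V w z = 0 := by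
    rw [Finset.sum_congr rfl fun w hw => by rw [hexp w hw]]
    simp_rw [Finset.sum_mul]
    rw [Finset.sum_comm]
    refine Finset.sum_eq_zero fun t ht => ?_
    have := hz t ht
    simp_rw [mul_assoc]
    rw [← Finset.mul_sum, this, mul_zero]
  rw [← hsum, ← Finset.sum_subset hW₀]
  · refine Finset.sum_congr rfl fun w hw => ?_
    rw [Finset.prod_eq_one, one_mul]
    intro v hv
    rw [ha₀ w hw, ArithmeticFunction.one_apply_ne (hN1 v hv), mul_zero, add_zero]
  · intro w hw hw0
    have hw1 : w ∈ W₁ := Finset.mem_sdiff.mpr ⟨hw, hw0⟩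
    rw [Finset.prod_eq_zero hw1, zero_mul]
    rw [neg_mul, inv_mul_cancel₀ (haN w hw1), add_neg_cancel]

/-- In the region `κ log(|Im z| + 10) ≤ Re z`, exponential decay in `Re z` beats powers of `z`. -/
theorem exists_rpow_mul_exp_lt (B C : ℝ) {τ : ℝ} (hτ : 0 < τ) :
    ∃ κ x₁ : ℝ, 0 < κ ∧ ∀ z : ℂ, x₁ ≤ z.re → κ * Real.log (|z.im| + 10) ≤ z.re →
      C * ‖z‖ ^ B * Real.exp (-τ * z.re) < 1 := by
  set B' := max B 0 with hB'
  have hB0 : 0 ≤ B' := le_max_right _ _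
  -- The region gives ‖z‖ ≤ (κ + 1) exp(Re z / κ). This κ makes the B'-th power grow at most like
  -- exp(τ Re z / 2), leaving half of the exponential decay.
  set κ : ℝ := 2 * (B' + 1) / τ with hκ
  have hκ0 : 0 < κ := by positivity
  have hlim : Tendsto (fun x : ℝ => |C| * (κ + 1) ^ B' * Real.exp (-(τ / 2) * x)) atTop (𝓝 0) := by
    have h1 : Tendsto (fun x : ℝ => Real.exp (-(τ / 2 * x))) atTop (𝓝 0) :=
      Real.tendsto_exp_neg_atTop_nhds_zero.comp (tendsto_id.const_mul_atTop (by positivity))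
    have h2 := h1.const_mul (|C| * (κ + 1) ^ B')
    simpa [neg_mul] using h2
  obtain ⟨x₁, hx₁⟩ := eventually_atTop.mp (hlim.eventually_lt_const one_pos)
  refine ⟨κ, max x₁ 1, hκ0, fun z hz hlog => ?_⟩
  have hx1 : 1 ≤ z.re := (le_max_right _ _).trans hz
  have hzn : 1 ≤ ‖z‖ := hx1.trans (Complex.re_le_norm z)
  have him : |z.im| + 10 ≤ Real.exp (z.re / κ) := by
    rw [← Real.log_le_iff_le_exp (by positivity), le_div_iff₀ hκ0]
    linarith
  have hre : z.re ≤ κ * Real.exp (z.re / κ) := by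
    have := Real.add_one_le_exp (z.re / κ)
    have h2 : z.re = κ * (z.re / κ) := by field_simp
    nlinarith
  have hnorm : ‖z‖ ≤ (κ + 1) * Real.exp (z.re / κ) := by
    have := Complex.norm_le_abs_re_add_abs_im z
    rw [abs_of_nonneg (by linarith : 0 ≤ z.re)] at this
    linarith
  have hpow : ‖z‖ ^ B ≤ (κ + 1) ^ B' * Real.exp (τ / 2 * z.re) := by
    calc ‖z‖ ^ B ≤ ‖z‖ ^ B' := Real.rpow_le_rpow_of_exponent_le hzn (le_max_left _ _)
      _ ≤ ((κ + 1) * Real.exp (z.re / κ)) ^ B' := Real.rpow_le_rpow (by linarith) hnorm hB0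
      _ = (κ + 1) ^ B' * Real.exp (z.re / κ * B') := by
        rw [Real.mul_rpow (by linarith) (Real.exp_pos _).le, ← Real.exp_mul]
      _ ≤ _ := by
        refine mul_le_mul_of_nonneg_left (Real.exp_le_exp.mpr ?_) (by positivity)
        rw [hκ]
        have : z.re / (2 * (B' + 1) / τ) * B' = τ / 2 * z.re * (B' / (B' + 1)) := by field_simp
        rw [this]
        have h3 : B' / (B' + 1) ≤ 1 := by rw [div_le_one (by linarith)]; linarith
        have h4 : 0 ≤ τ / 2 * z.re := by positivity
        nlinarith
  calc C * ‖z‖ ^ B * Real.exp (-τ * z.re)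
      ≤ |C| * ((κ + 1) ^ B' * Real.exp (τ / 2 * z.re)) * Real.exp (-τ * z.re) := by
        gcongr
        exact le_abs_self C
    _ = |C| * (κ + 1) ^ B' * Real.exp (-(τ / 2) * z.re) := by
        rw [mul_assoc, mul_assoc, ← Real.exp_add, ← mul_assoc]
        ring_nf
    _ < 1 := hx₁ _ ((le_max_left _ _).trans hz)

/-- Nonvanishing of finite sums `∑ V_w(z) L(a_w, z)` with hypergeometric coefficients `V_w`. -/
theorem exists_region_sum_ne_zero {κ : Type*} [DecidableEq κ] (W W₀ : Finset κ) (hW₀ : W₀ ⊆ W)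
    (V : κ → ℂ → ℂ) (a : κ → ArithmeticFunction ℂ) (σ : ℝ)
    (hV : ∀ w ∈ W, (∀ᶠ z in reTop, V w z = 0) ∨ ∃ e, IsHypergeometric (V w) e)
    (hsum : ∀ w ∈ W, LSeriesSummable (fun n => a w n) σ)
    (ha : ∀ w ∈ W, (a w).IsMultiplicative) (ha₀ : ∀ w ∈ W₀, a w = 1)
    (ha₁ : ∀ w ∈ W, w ∉ W₀ → ∃ m : ℕ, 0 < m ∧ ∀ q : ℕ, q.Prime → a w (q ^ m) ≠ 0)
    (hne : ¬ ∀ᶠ z in reTop, ∑ w ∈ W₀, V w z = 0) :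
    ∃ κ x₁ : ℝ, 0 < κ ∧ ∀ z : ℂ, x₁ ≤ z.re → κ * Real.log (|z.im| + 10) ≤ z.re →
      ∑ w ∈ W, V w z * LSeries (fun n => a w n) z ≠ 0 := by
  classical
  set G : ℕ → ℂ → ℂ := fun n z => ∑ w ∈ W, a w n * V w z with hG
  have hex : ∃ n, ¬ ∀ᶠ z in reTop, G n z = 0 := by
    by_contra! h
    exact hne (eventually_sum_eq_zero_of_forall_coeff W W₀ hW₀ V a ha ha₀ ha₁ h)
  set n := Nat.find hex with hn
  have hGn : ¬ ∀ᶠ z in reTop, G n z = 0 := Nat.find_spec hex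
  have hGlt : ∀ m < n, ∀ᶠ z in reTop, G m z = 0 := fun m hm => not_not.mp (Nat.find_min hex hm)
  -- Arithmetic functions take the value 0 at 0, so the index 0 never qualifies.
  have hn0 : n ≠ 0 := by
    intro h0
    apply hGn
    rw [h0]
    simp [hG]
  obtain ⟨c, e, hc, hGlim⟩ : ∃ (c : ℂ) (e : ℝ), c ≠ 0 ∧
      Tendsto (fun z => G n z / z ^ (e : ℂ)) reTop (𝓝 c) := by
    set T := W.filter fun w => a w n ≠ 0 ∧ ¬ ∀ᶠ z in reTop, V w z = 0 with hT
    have h1 : ∀ w ∈ T, ∃ e, IsHypergeometric (fun z => a w n * V w z) e := by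
      intro w hw
      simp only [hT, Finset.mem_filter] at hw
      obtain ⟨e, he⟩ := (hV w hw.1).resolve_left hw.2.2
      exact ⟨_, (IsHypergeometric.const hw.2.1).mul he⟩
    choose! e he using h1
    have h2 : ∀ᶠ z in reTop, ∑ w ∈ T, a w n * V w z = G n z := by
      have h3 : ∀ᶠ z in reTop, ∀ w ∈ W, w ∉ T → a w n * V w z = 0 := by
        rw [eventually_all_finset]
        intro w hw
        by_cases hwn : a w n = 0
        · simp [hwn]
        · by_cases hwV : ∀ᶠ z in reTop, V w z = 0
          · filter_upwards [hwV] with z hz _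
            rw [hz, mul_zero]
          · refine Eventually.of_forall fun z hwT => absurd ?_ hwT
            simp only [hT, Finset.mem_filter]
            exact ⟨hw, hwn, hwV⟩
      filter_upwards [h3] with z h3
      exact Finset.sum_subset (Finset.filter_subset _ _) fun w hw hwT => h3 w hw hwT
    rcases sum_eventually_zero_or_asymptotic _ T rfl _ e he with h | ⟨c, b, hc, -, h⟩
    · refine absurd ?_ hGn
      filter_upwards [h, h2] with z h h2
      rw [← h2, h]
    · refine ⟨c, b, hc, h.congr' ?_⟩
      filter_upwards [h2] with z h2
      rw [h2]
  have hVbd : ∀ w ∈ W, ∃ (A : ℝ) (K : ℝ), 0 ≤ K ∧ ∀ᶠ z in reTop, ‖V w z‖ ≤ K * ‖z‖ ^ A := by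
    intro w hw
    rcases hV w hw with h | ⟨e, he⟩
    · refine ⟨0, 0, le_rfl, ?_⟩
      filter_upwards [h] with z hz
      simp [hz]
    · obtain ⟨c, -, hc⟩ := he.asymptotic
      exact ⟨e, ‖c‖ + 1, by positivity, exists_norm_le_of_tendsto_div_cpow hc⟩
  choose! A K hK hVbd using hVbd
  choose! Ct hCt hCtail using fun w (hw : w ∈ W) => exists_norm_LSeries_sub_le (hsum w hw) n
  obtain ⟨A', hA'⟩ : ∃ A' : ℝ, ∀ w ∈ W, A w ≤ A' := by
    obtain ⟨A', h⟩ := (W.image A).bddAbove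
    exact ⟨A', fun w hw => h (by simpa using ⟨w, hw, rfl⟩)⟩
  have hnp : (0 : ℝ) < n := by positivity
  -- The tail relative to the term n^{-z} is of size (n/(n+1))^{Re z} = exp(-τ Re z).
  set τ : ℝ := Real.log (n + 1) - Real.log n with hτ
  have hτ0 : 0 < τ := sub_pos.mpr (Real.log_lt_log hnp (by linarith))
  set Cs : ℝ := ∑ w ∈ W, K w * Ct w with hCs
  have hc0 : 0 < ‖c‖ := norm_pos_iff.mpr hc
  -- A zero of the sum would equate G n, of size at least ‖c‖/2 · ‖z‖^e, with a quantity of size at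
  -- most Cs ‖z‖^{A'} exp(-τ Re z); the parameters make the ratio of these bounds less than 1.
  obtain ⟨κ', x₁, hκ', hreg⟩ := exists_rpow_mul_exp_lt (A' - e) (2 * Cs / ‖c‖) hτ0
  have hVall : ∀ᶠ z in reTop, ∀ w ∈ W, ‖V w z‖ ≤ K w * ‖z‖ ^ A w := by
    rw [eventually_all_finset]; exact hVbd
  have hGall : ∀ᶠ z in reTop, ∀ m ∈ Finset.range n, G m z = 0 := by
    rw [eventually_all_finset]
    exact fun m hm => hGlt m (Finset.mem_range.mp hm)
  obtain ⟨x₂, hx₂⟩ := eventually_reTop.mp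
    (hVall.and (hGall.and (eventually_le_norm_of_tendsto_div_cpow hc hGlim)))
  refine ⟨κ', max x₁ (max x₂ (max σ 1)), hκ', fun z hz hlog h0 => ?_⟩
  simp only [max_le_iff] at hz
  obtain ⟨hz1, hz2, hz3, hz4⟩ := hz
  obtain ⟨b1, b2, b3⟩ := hx₂ z hz2
  have hzn : 1 ≤ ‖z‖ := hz4.trans (Complex.re_le_norm z)
  have hncp : (n : ℂ) ^ z ≠ 0 := cpow_ne_zero_of_ne_zero (by exact_mod_cast hn0) _
  have hmainsum : ∑ w ∈ W, V w z * ∑ m ∈ Finset.range (n + 1),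
      LSeries.term (fun n => a w n) z m = G n z / (n : ℂ) ^ z := by
    simp_rw [Finset.mul_sum]
    rw [Finset.sum_comm, Finset.sum_range_succ]
    have hterm : ∀ m, ∑ w ∈ W, V w z * LSeries.term (fun n => a w n) z m =
        if m = 0 then 0 else G m z / (m : ℂ) ^ z := by
      intro m
      split_ifs with hm
      · simp [hm]
      · simp only [hG, Finset.sum_div, LSeries.term_of_ne_zero hm]
        exact Finset.sum_congr rfl fun w _ => by ring
    rw [Finset.sum_eq_zero, zero_add, hterm, if_neg hn0]
    intro m hm
    rw [hterm, b2 m hm]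
    simp
  have hdiff : G n z / (n : ℂ) ^ z = -∑ w ∈ W, V w z * (LSeries (fun n => a w n) z -
      ∑ m ∈ Finset.range (n + 1), LSeries.term (fun n => a w n) z m) := by
    simp_rw [mul_sub]
    rw [Finset.sum_sub_distrib, h0, hmainsum]
    ring
  have hbound : ‖G n z‖ ≤ Cs * ‖z‖ ^ A' * Real.exp (-τ * z.re) := by
    have h1 : ‖G n z / (n : ℂ) ^ z‖ ≤ ∑ w ∈ W, K w * Ct w * ‖z‖ ^ A' * ((n : ℝ) + 1) ^ (-z.re) := by
      rw [hdiff, norm_neg]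
      refine (norm_sum_le _ _).trans (Finset.sum_le_sum fun w hw => ?_)
      rw [norm_mul]
      have h2 := hCtail w hw z hz3
      have h3 : ‖V w z‖ ≤ K w * ‖z‖ ^ A' := (b1 w hw).trans
        (mul_le_mul_of_nonneg_left (Real.rpow_le_rpow_of_exponent_le hzn (hA' w hw)) (hK w hw))
      calc _ ≤ (K w * ‖z‖ ^ A') * (Ct w * ((n : ℝ) + 1) ^ (-z.re)) :=
            mul_le_mul h3 h2 (norm_nonneg _) (mul_nonneg (hK w hw) (by positivity))
        _ = _ := by ring
    rw [norm_div, ← Complex.ofReal_natCast, Complex.norm_cpow_eq_rpow_re_of_pos hnp,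
      div_le_iff₀ (by positivity), ← Finset.sum_mul, ← Finset.sum_mul] at h1
    refine h1.trans_eq ?_
    have h4 : ((n : ℝ) + 1) ^ (-z.re) * (n : ℝ) ^ z.re = Real.exp (-τ * z.re) := by
      rw [Real.rpow_def_of_pos (by positivity), Real.rpow_def_of_pos hnp, ← Real.exp_add, hτ]
      ring_nf
    rw [mul_assoc, h4]
  have hlt := hreg z hz1 hlog
  have hze : 0 < ‖z‖ ^ e := by positivity
  have h5 : ‖z‖ ^ A' = ‖z‖ ^ (A' - e) * ‖z‖ ^ e := by
    rw [← Real.rpow_add (by linarith)]; ring_nf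
  rw [h5] at hbound
  have h6 : ‖c‖ / 2 * ‖z‖ ^ e ≤
      ‖c‖ / 2 * ‖z‖ ^ e * (2 * Cs / ‖c‖ * ‖z‖ ^ (A' - e) * Real.exp (-τ * z.re)) := by
    refine (b3.trans hbound).trans_eq ?_
    field_simp
  have h7 : 0 < ‖c‖ / 2 * ‖z‖ ^ e := by positivity
  nlinarith

end WengZeta

/-! ### Root systems: positivity, roots of full support, heights of coroots -/

namespace WengZeta
set_option linter.unusedSectionVars false
open RootPairing
open scoped Classical

section
variable {ι M N : Type*} [Fintype ι] [AddCommGroup M] [Module ℝ M] [AddCommGroup N] [Module ℝ N]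
  {P : RootPairing ι ℝ M N} (b : P.Base)

theorem isPos_reflectionPerm_self_iff (i : ι) :
    b.IsPos (P.reflectionPerm i i) ↔ ¬ b.IsPos i :=
  Base.IsPos.neg_iff_not b i

theorem root_eq_sum_nat_of_isPos {i : ι} (hi : b.IsPos i) :
    ∃ f : ι → ℕ, P.root i = ∑ j ∈ b.support, f j • P.root j := by
  obtain ⟨f, -, h | h⟩ := b.exists_root_eq_sum_nat_or_neg i
  · exact ⟨f, h⟩
  · exfalso
    have h1 : P.root i = ∑ j ∈ b.support, (-(f j : ℤ)) • P.root j := by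
      rw [h]; simp
    rw [Base.isPos_iff, Base.height_eq_sum h1] at hi
    have : ∑ j ∈ b.support, (-(f j : ℤ)) ≤ 0 := Finset.sum_nonpos fun j _ => by simp
    omega

variable [P.IsCrystallographic] [P.IsReduced]

theorem isPos_reflectionPerm_iff {i j : ι} (hj : j ∈ b.support) (h1 : i ≠ j)
    (h2 : i ≠ P.reflectionPerm j j) : b.IsPos (P.reflectionPerm j i) ↔ b.IsPos i := by
  refine ⟨fun h => ?_, fun h => h.reflectionPerm hj h1⟩
  have h3 : P.reflectionPerm j i ≠ j := fun h3 => h2 (by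
    rw [← P.reflectionPerm_self j i, h3])
  have := h.reflectionPerm hj h3
  rwa [P.reflectionPerm_self] at this

/-- Positivity of roots and of coroots agrees on simple roots and changes in the same way under
simple reflections, which reach every root. -/
theorem flip_isPos_iff (i : ι) : b.flip.IsPos i ↔ b.IsPos i := by
  refine b.induction_reflect i (p := fun i => b.flip.IsPos i ↔ b.IsPos i) ?_ ?_ ?_
  · intro i h
    rw [isPos_reflectionPerm_self_iff, ← h]
    exact isPos_reflectionPerm_self_iff b.flip i
  · intro i hi
    exact ⟨fun _ => Base.isPos_of_mem_support hi,
      fun _ => Base.isPos_of_mem_support (b := b.flip) hi⟩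
  · intro i j h hj
    by_cases h1 : i = j
    · subst h1
      rw [isPos_reflectionPerm_self_iff, ← h]
      exact isPos_reflectionPerm_self_iff b.flip i
    · by_cases h2 : i = P.reflectionPerm j j
      · subst h2
        rw [P.reflectionPerm_self]
        exact ⟨fun _ => Base.isPos_of_mem_support hj,
          fun _ => Base.isPos_of_mem_support (b := b.flip) hj⟩
      · rw [isPos_reflectionPerm_iff b hj h1 h2, ← h]
        exact isPos_reflectionPerm_iff b.flip hj h1 h2

/-- The reflection in a simple root permutes the other positive roots and negates their pairing with
its coroot, so only that simple root contributes. This yields ⟨ρ, α_j^∨⟩ = 1. -/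
theorem sum_pairing_isPos {j : ι} (hj : j ∈ b.support) :
    ∑ i with b.IsPos i, P.pairing i j = 2 := by
  have hjpos : j ∈ Finset.univ.filter fun i => b.IsPos i := by
    simpa using Base.isPos_of_mem_support hj
  rw [← Finset.add_sum_erase _ _ hjpos, P.pairing_same]
  have hmem : ∀ i ∈ (Finset.univ.filter fun i => b.IsPos i).erase j,
      P.reflectionPerm j i ∈ (Finset.univ.filter fun i => b.IsPos i).erase j := by
    intro i hi
    simp only [Finset.mem_erase, Finset.mem_filter, Finset.mem_univ, true_and] at hi ⊢
    refine ⟨fun h => ?_, hi.2.reflectionPerm hj hi.1⟩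
    have h2 : i = P.reflectionPerm j j := by
      rw [← P.reflectionPerm_self j i, h]
    have h3 := hi.2
    rw [h2, isPos_reflectionPerm_self_iff] at h3
    exact h3 (Base.isPos_of_mem_support hj)
  have h : ∑ i ∈ (Finset.univ.filter fun i => b.IsPos i).erase j, P.pairing i j =
      ∑ i ∈ (Finset.univ.filter fun i => b.IsPos i).erase j, -P.pairing i j := by
    refine Finset.sum_nbij' (P.reflectionPerm j) (P.reflectionPerm j) hmem hmem ?_ ?_ ?_
    · intro i _; exact P.reflectionPerm_self j i
    · intro i _; exact P.reflectionPerm_self j i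
    · intro i _
      have : P.pairing (P.reflectionPerm j i) j = -P.pairing i j := by
        rw [← P.pairing_reflectionPerm, P.pairing_reflectionPerm_self_right]
      rw [this, neg_neg]
  rw [Finset.sum_neg_distrib] at h
  linarith

variable [P.IsRootSystem]

/-- An irreducible root system has a positive root whose support is the whole base. -/
theorem exists_isPos_forall_coord_root_ne_zero [P.IsIrreducible] :
    ∃ i, b.IsPos i ∧ ∀ j, b.toWeightBasis.coord j (P.root i) ≠ 0 := by
  have hne : Nonempty ι := by
    by_contra h
    rw [not_nonempty_iff] at h
    have h1 : (⊥ : Submodule ℝ M) = ⊤ := by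
      rw [← IsRootSystem.span_root_eq_top (P := P), Set.range_eq_empty, Submodule.span_empty]
    have := IsIrreducible.nontrivial P
    exact bot_ne_top h1
  -- A root of maximal height works. If its support S missed some simple roots, irreducibility would
  -- be contradicted through the span of S.
  obtain ⟨i, -, hmax⟩ := Finset.univ.exists_max_image b.height (Finset.univ_nonempty (α := ι))
  have hi : b.IsPos i := by
    by_contra h
    rw [← isPos_reflectionPerm_self_iff] at h
    have h1 := hmax _ (Finset.mem_univ (P.reflectionPerm i i))
    have h2 : b.height (P.reflectionPerm i i) = -b.height i := b.height_reflectionPerm_self i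
    rw [Base.isPos_iff, h2] at h
    omega
  refine ⟨i, hi, ?_⟩
  obtain ⟨f, hf⟩ := root_eq_sum_nat_of_isPos b hi
  set S : Set ι := {j | j ∈ b.support ∧ f j ≠ 0} with hS
  have hSne : S.Nonempty := by
    by_contra h
    rw [Set.not_nonempty_iff_eq_empty] at h
    apply P.ne_zero i
    rw [hf]
    refine Finset.sum_eq_zero fun j hj => ?_
    have : j ∉ S := by rw [h]; simp
    have : f j = 0 := by
      by_contra h0
      exact this ⟨hj, h0⟩
    simp [this]
  -- For simple j outside S, the pairing of the root i with j is a sum of nonpositive terms. It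
  -- cannot be negative, since the sum of the two roots would then be a root of larger height. So
  -- every term vanishes.
  have horth : ∀ j ∈ b.support, j ∉ S → ∀ k ∈ S, P.pairing k j = 0 := by
    intro j hj hjS k hk
    have hterm : ∀ k ∈ b.support, (f k : ℤ) * P.pairingIn ℤ k j ≤ 0 := by
      intro k hk
      by_cases hkj : k = j
      · subst hkj
        have : f k = 0 := by
          by_contra h0
          exact hjS ⟨hk, h0⟩
        simp [this]
      · have := b.pairingIn_le_zero_of_ne hkj hk hj
        exact mul_nonpos_of_nonneg_of_nonpos (by positivity) this
    have hsum : P.pairingIn ℤ i j = ∑ k ∈ b.support, (f k : ℤ) * P.pairingIn ℤ k j := by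
      have h1 : P.pairing i j = ∑ k ∈ b.support, (f k : ℝ) * P.pairing k j := by
        rw [← P.root_coroot_eq_pairing, hf]
        simp [P.root_coroot_eq_pairing]
      have h2 : ∀ k, P.pairing k j = (P.pairingIn ℤ k j : ℝ) := fun k => by
        simpa using (P.algebraMap_pairingIn ℤ k j).symm
      simp only [h2] at h1
      exact_mod_cast h1
    have hge : 0 ≤ P.pairingIn ℤ i j := by
      by_contra! hlt
      have hij : P.root i ≠ -P.root j := by
        intro h
        have h1 : i = P.reflectionPerm j j := P.root.injective (by rw [h]; simp)
        rw [h1, isPos_reflectionPerm_self_iff] at hi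
        exact hi (Base.isPos_of_mem_support hj)
      obtain ⟨l, hl⟩ := P.root_add_root_mem_of_pairingIn_neg hlt hij
      have h1 := b.height_add hl
      rw [Base.height_one_of_mem_support hj] at h1
      have := hmax l (Finset.mem_univ _)
      omega
    rw [hsum] at hge
    have h3 := (Finset.sum_eq_zero_iff_of_nonpos hterm).mp
      (le_antisymm (Finset.sum_nonpos hterm) hge) k hk.1
    have h4 : P.pairingIn ℤ k j = 0 := by
      rcases mul_eq_zero.mp h3 with h | h
      · exact absurd (by exact_mod_cast h) hk.2
      · exact h
    rw [← P.algebraMap_pairingIn ℤ, h4, map_zero]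
  -- The span of S is stable under the simple reflections: those in S act within it, and those
  -- outside S fix it pointwise. Irreducibility then forces it to be the whole space.
  have htop : Submodule.span ℝ (P.root '' S) = ⊤ := by
    refine IsIrreducible.eq_top_of_invtSubmodule_reflection (P := P) _ ?_ ?_
    · rw [← b.forall_mem_support_invtSubmodule_iff]
      intro j hj
      by_cases hjS : j ∈ S
      · exact Submodule.mem_invtSubmodule_reflection_of_mem _ _
          (Submodule.subset_span ⟨j, hjS, rfl⟩)
      · rw [Module.End.mem_invtSubmodule, Submodule.span_le]
        rintro - ⟨k, hk, rfl⟩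
        have : P.reflection j (P.root k) = P.root k := by
          rw [P.reflection_apply_root, horth j hj hjS k hk, zero_smul, sub_zero]
        rw [SetLike.mem_coe, Submodule.mem_comap, LinearEquiv.coe_coe, this]
        exact Submodule.subset_span ⟨k, hk, rfl⟩
    · obtain ⟨k, hk⟩ := hSne
      intro h
      have : P.root k ∈ Submodule.span ℝ (P.root '' S) := Submodule.subset_span ⟨k, hk, rfl⟩
      rw [h] at this
      exact P.ne_zero k (by simpa using this)
  intro j hj0
  have hjS : (j : ι) ∉ S := by
    intro h
    rw [hf, map_sum, Finset.sum_eq_single_of_mem (j : ι) j.2] at hj0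
    · simp at hj0
      exact h.2 hj0
    · intro k hk hkj
      have := b.toWeightBasis_repr_root ⟨k, hk⟩
      rw [map_nsmul, Module.Basis.coord_apply, this, Finsupp.single_apply, if_neg, smul_zero]
      exact fun h => hkj (congrArg Subtype.val h)
  have hle : Submodule.span ℝ (P.root '' S) ≤ LinearMap.ker (b.toWeightBasis.coord j) := by
    rw [Submodule.span_le]
    rintro - ⟨k, hk, rfl⟩
    have := b.toWeightBasis_repr_root ⟨k, hk.1⟩
    rw [SetLike.mem_coe, LinearMap.mem_ker, Module.Basis.coord_apply, this, Finsupp.single_apply,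
      if_neg]
    rintro rfl
    exact hjS hk
  rw [htop] at hle
  have h5 := hle (Submodule.mem_top (x := P.root j))
  rw [LinearMap.mem_ker] at h5
  simp at h5

end

/-! ### Coordinates of coroots in the simple coroots, and the action of the Weyl group -/

variable {ι M N : Type*} [Fintype ι] [AddCommGroup M] [Module ℝ M] [AddCommGroup N] [Module ℝ N]
  {P : RootPairing ι ℝ M N} [P.IsRootSystem] (b : P.Base) (p : b.support)

/-- The coefficient of the simple coroot `j` in the coroot `i`. -/
noncomputable def cocoord (j : b.support) (i : ι) : ℝ := b.toCoweightBasis.coord j (P.coroot i)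

theorem lam_eq_cocoord (i : ι) : lam b p i = cocoord b p i := by
  rw [lam, fundamentalWeight, LinearMap.apply_symm_toPerfPair_self, cocoord]

theorem coroot_eq_sum_cocoord (i : ι) :
    P.coroot i = ∑ j : b.support, cocoord b j i • P.coroot j := by
  conv_lhs => rw [← b.toCoweightBasis.sum_repr (P.coroot i)]
  simp [cocoord]

theorem cocoord_simple (j k : b.support) : cocoord b j k = if k = j then 1 else 0 := by
  simp [cocoord, Finsupp.single_apply]

theorem cocoord_reflectionPerm_self (j : b.support) (i : ι) :
    cocoord b j (P.reflectionPerm i i) = -cocoord b j i := by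
  simp [cocoord]

theorem exists_coroot_equiv (w : P.weylGroup) :
    ∃ T : N ≃ₗ[ℝ] N, ∀ i, T (P.coroot i) = P.coroot (P.weylGroupToPerm w i) := by
  -- The coweight map of an automorphism is contravariant, so its inverse carries the coroot of a
  -- root to the coroot of its image under w.
  refine ⟨(RootPairing.Equiv.coweightEquiv P P (w : P.Aut)).symm, fun i => ?_⟩
  rw [LinearEquiv.symm_apply_eq]
  have := Hom.coroot_coweightMap_apply P P (P.weylGroupToPerm w i) (w : P.Aut).toHom
  simpa using this.symm

variable [P.IsCrystallographic] [P.IsReduced]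

theorem exists_nat_eq_cocoord {i : ι} (hi : b.IsPos i) :
    ∃ f : b.support → ℕ, ∀ j, cocoord b j i = f j := by
  obtain ⟨f, hf⟩ := root_eq_sum_nat_of_isPos b.flip ((flip_isPos_iff b i).mpr hi)
  refine ⟨fun j => f j, fun j => ?_⟩
  change P.coroot i = ∑ j ∈ b.support, f j • P.coroot j at hf
  rw [cocoord, hf, map_sum, Finset.sum_eq_single_of_mem (j : ι) j.2]
  · simp
  · intro k hk hkj
    have := b.toCoweightBasis_repr_coroot ⟨k, hk⟩
    rw [map_nsmul, Module.Basis.coord_apply, this, Finsupp.single_apply, if_neg, smul_zero]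
    exact fun h => hkj (congrArg Subtype.val h)

theorem cocoord_nonneg {i : ι} (hi : b.IsPos i) (j : b.support) : 0 ≤ cocoord b j i := by
  obtain ⟨f, hf⟩ := exists_nat_eq_cocoord b hi
  rw [hf]; positivity

theorem cocoord_nonpos {i : ι} (hi : ¬ b.IsPos i) (j : b.support) : cocoord b j i ≤ 0 := by
  rw [← isPos_reflectionPerm_self_iff] at hi
  have := cocoord_nonneg b hi j
  rw [cocoord_reflectionPerm_self] at this
  linarith

theorem weylVector_simple_coroot {j : ι} (hj : j ∈ b.support) : ht b j = 1 := by
  rw [ht, weylVector]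
  have := sum_pairing_isPos b hj
  simp only [map_smul, map_sum, LinearMap.smul_apply, LinearMap.sum_apply,
    P.root_coroot_eq_pairing, smul_eq_mul]
  rw [this]
  norm_num

theorem ht_eq_sum_cocoord (i : ι) : ht b i = ∑ j : b.support, cocoord b j i := by
  have h : ∀ k : b.support, P.toLinearMap (weylVector b) (P.coroot k) = 1 :=
    fun k => weylVector_simple_coroot b k.2
  rw [ht, coroot_eq_sum_cocoord b i, map_sum]
  simp [h]

/-- The level and the height of a positive root are natural numbers. -/
theorem exists_nat_lam_ht {i : ι} (hi : b.IsPos i) :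
    ∃ k h : ℕ, lam b p i = k ∧ ht b i = h ∧ 1 ≤ h := by
  obtain ⟨f, hf⟩ := exists_nat_eq_cocoord b hi
  refine ⟨f p, ∑ j, f j, by rw [lam_eq_cocoord, hf], by simp [ht_eq_sum_cocoord, hf], ?_⟩
  by_contra h
  have h0 : ∀ j, f j = 0 := fun j =>
    Finset.sum_eq_zero_iff.mp (by omega : ∑ j, f j = 0) j (Finset.mem_univ j)
  apply P.flip.ne_zero i
  change P.coroot i = 0
  rw [coroot_eq_sum_cocoord b i]
  simp [hf, h0]

theorem mem_support_of_ht_eq_one {i : ι} (h1 : ht b i = 1) : i ∈ b.support := by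
  have hi : b.IsPos i := by
    by_contra h
    have : ht b i ≤ 0 := by
      rw [ht_eq_sum_cocoord]
      exact Finset.sum_nonpos fun j _ => cocoord_nonpos b h j
    linarith
  obtain ⟨f, hf⟩ := exists_nat_eq_cocoord b hi
  have hs : ∑ j, f j = 1 := by
    rw [ht_eq_sum_cocoord] at h1
    simp only [hf] at h1
    exact_mod_cast h1
  obtain ⟨j, -, hj⟩ : ∃ j ∈ Finset.univ, f j ≠ 0 := by
    by_contra! h
    rw [Finset.sum_eq_zero h] at hs
    omega
  have hrest : ∀ k, k ≠ j → f k = 0 := by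
    intro k hk
    have h2 := Finset.add_sum_erase Finset.univ f (Finset.mem_univ j)
    have h3 : f k ≤ ∑ x ∈ Finset.univ.erase j, f x :=
      Finset.single_le_sum (fun _ _ => Nat.zero_le _) (by simp [hk])
    omega
  have hfj : f j = 1 := by
    rw [Finset.sum_eq_single_of_mem j (Finset.mem_univ j) fun k _ hk => hrest k hk] at hs
    exact hs
  have : P.coroot i = P.coroot j := by
    rw [coroot_eq_sum_cocoord b i, Finset.sum_eq_single_of_mem j (Finset.mem_univ j)]
    · simp [hf, hfj]
    · intro k _ hk
      simp [hf, hrest k hk]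
  rw [P.coroot.injective this]
  exact j.2

/-- The statement for roots, applied to the dual system, whose positive roots have the same indices.
-/
theorem exists_isPos_forall_cocoord_ne_zero [P.IsIrreducible] :
    ∃ i, b.IsPos i ∧ ∀ j, cocoord b j i ≠ 0 := by
  obtain ⟨i, hi, h⟩ := exists_isPos_forall_coord_root_ne_zero b.flip
  exact ⟨i, (flip_isPos_iff b i).mp hi, h⟩

/-- If `w` maps every simple root to a simple or a negative root, and some positive root with full
support to a positive root, then it maps simple roots to simple roots. -/
theorem map_simple_of_isPos {w : P.weylGroup}
    (hw : ∀ j ∈ b.support, P.weylGroupToPerm w j ∈ b.support ∨ ¬ PosAt b w j)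
    {i : ι} (hi : b.IsPos i) (hfull : ∀ j, cocoord b j i ≠ 0) (hwi : PosAt b w i) :
    ∀ j ∈ b.support, P.weylGroupToPerm w j ∈ b.support := by
  by_contra! hcon
  obtain ⟨j₀, hj₀, hj₀'⟩ := hcon
  obtain ⟨T, hT⟩ := exists_coroot_equiv w
  have hneg : ¬ PosAt b w j₀ := (hw j₀ hj₀).resolve_left hj₀'
  have hexp : ∀ m : b.support, cocoord b m (P.weylGroupToPerm w i) =
      ∑ j : b.support, cocoord b j i * cocoord b m (P.weylGroupToPerm w j) := by
    intro m
    rw [cocoord, ← hT i, coroot_eq_sum_cocoord b i, map_sum, map_sum]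
    refine Finset.sum_congr rfl fun j _ => ?_
    rw [map_smul, map_smul, hT, smul_eq_mul]
    rfl
  -- If m is not the image of a simple root, every term of the m-coordinate of the image of i is
  -- nonpositive, while the total is nonnegative. Full support then forces the m-coordinate of each
  -- image of a simple coroot to vanish.
  have hzero : ∀ m : b.support, (∀ j ∈ b.support, P.weylGroupToPerm w j ≠ m) →
      cocoord b m (P.weylGroupToPerm w j₀) = 0 := by
    intro m hm
    have hle : ∀ j ∈ (Finset.univ : Finset b.support),
        cocoord b j i * cocoord b m (P.weylGroupToPerm w j) ≤ 0 := by
      intro j _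
      refine mul_nonpos_of_nonneg_of_nonpos (cocoord_nonneg b hi j) ?_
      rcases hw j j.2 with h | h
      · have := cocoord_simple b m ⟨_, h⟩
        rw [this, if_neg]
        intro h'
        exact hm j j.2 (congrArg Subtype.val h')
      · exact cocoord_nonpos b h m
    have h1 : 0 ≤ cocoord b m (P.weylGroupToPerm w i) := cocoord_nonneg b hwi m
    rw [hexp] at h1
    have h2 := (Finset.sum_eq_zero_iff_of_nonpos hle).mp
      (le_antisymm (Finset.sum_nonpos hle) h1) ⟨j₀, hj₀⟩ (Finset.mem_univ _)
    exact (mul_eq_zero.mp h2).resolve_left (hfull _)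
  -- So the image of j₀ is a combination of simple coroots that are themselves images of simple
  -- coroots. Pulling back by w writes the coroot of j₀ in terms of simple coroots other than
  -- itself.
  have hcontra : cocoord b ⟨j₀, hj₀⟩ j₀ = 0 := by
    have h1 : P.coroot j₀ = ∑ m : b.support,
        cocoord b m (P.weylGroupToPerm w j₀) • T.symm (P.coroot m) := by
      rw [← T.symm_apply_apply (P.coroot j₀), hT]
      conv_lhs => rw [coroot_eq_sum_cocoord b (P.weylGroupToPerm w j₀)]
      simp
    rw [cocoord, h1, map_sum]
    refine Finset.sum_eq_zero fun m _ => ?_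
    by_cases hm : ∀ j ∈ b.support, P.weylGroupToPerm w j ≠ m
    · rw [hzero m hm, zero_smul, map_zero]
    · push Not at hm
      obtain ⟨j, hj, hjm⟩ := hm
      have h2 : T.symm (P.coroot m) = P.coroot j := by
        rw [LinearEquiv.symm_apply_eq, hT, hjm]
      rw [h2, map_smul]
      have h3 := cocoord_simple b ⟨j₀, hj₀⟩ ⟨j, hj⟩
      rw [cocoord] at h3
      rw [h3, if_neg, smul_zero]
      intro h4
      have : j = j₀ := congrArg Subtype.val h4
      rw [this] at hjm
      exact hj₀' (hjm ▸ m.2)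
  have := cocoord_simple b ⟨j₀, hj₀⟩ ⟨j₀, hj₀⟩
  rw [if_pos rfl] at this
  simp only at this
  linarith

/-- A Weyl group element permuting the simple roots preserves positivity. -/
theorem posAt_of_map_simple {w : P.weylGroup}
    (hw : ∀ j ∈ b.support, P.weylGroupToPerm w j ∈ b.support) {i : ι} (hi : b.IsPos i) :
    PosAt b w i := by
  obtain ⟨T, hT⟩ := exists_coroot_equiv w
  by_contra hneg
  have h1 : P.coroot (P.weylGroupToPerm w i) = 0 := by
    rw [coroot_eq_sum_cocoord b (P.weylGroupToPerm w i)]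
    refine Finset.sum_eq_zero fun m _ => ?_
    -- The image is a nonnegative combination of simple coroots; if it were also negative, all
    -- coordinates would vanish.
    have h2 : 0 ≤ cocoord b m (P.weylGroupToPerm w i) := by
      rw [cocoord, ← hT i, coroot_eq_sum_cocoord b i, map_sum, map_sum]
      refine Finset.sum_nonneg fun j _ => ?_
      rw [map_smul, map_smul, hT, smul_eq_mul]
      exact mul_nonneg (cocoord_nonneg b hi j)
        (cocoord_nonneg b (Base.isPos_of_mem_support (hw j j.2)) m)
    rw [le_antisymm (cocoord_nonpos b hneg m) h2, zero_smul]
  exact P.flip.ne_zero _ h1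

theorem mem_support_iff_of_map_simple {w : P.weylGroup}
    (hw : ∀ j ∈ b.support, P.weylGroupToPerm w j ∈ b.support) (i : ι) :
    P.weylGroupToPerm w i ∈ b.support ↔ i ∈ b.support := by
  refine ⟨fun h => ?_, hw i⟩
  have h1 : b.support.map (P.weylGroupToPerm w).toEmbedding = b.support := by
    refine Finset.eq_of_subset_of_card_le ?_ (by simp)
    intro x hx
    obtain ⟨j, hj, rfl⟩ := Finset.mem_map.mp hx
    exact hw j hj
  rw [← h1] at h
  obtain ⟨j, hj, hji⟩ := Finset.mem_map.mp h
  rwa [← (P.weylGroupToPerm w).injective hji]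

end WengZeta

/-! ### The function ξ, its quotient under a unit shift, and a partial fraction criterion -/

namespace WengZeta
set_option linter.unusedSectionVars false
open Filter Topology Polynomial
open scoped Classical

theorem xi_one_sub (s : ℂ) : xi (1 - s) = xi s := by
  rw [xi, xi, completedRiemannZeta₀_one_sub]
  ring

theorem xi_ne_zero_of_one_le_re {s : ℂ} (hs : 1 ≤ s.re) : xi s ≠ 0 := by
  rcases eq_or_ne s 1 with rfl | h1
  · simp [xi]
  · have h0 : s ≠ 0 := by rintro rfl; norm_num at hs
    rw [xi_eq_of_re_pos s (by linarith) h1]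
    refine mul_ne_zero (mul_ne_zero h0 (sub_ne_zero.mpr h1)) (mul_ne_zero (mul_ne_zero
      (cpow_ne_zero_of_ne_zero (by simp [Real.pi_ne_zero]) _)
      (Complex.Gamma_ne_zero_of_re_pos ?_)) (riemannZeta_ne_zero_of_one_le_re hs))
    simp
    linarith

theorem xi_ne_zero_of_re_nonpos {s : ℂ} (hs : s.re ≤ 0) : xi s ≠ 0 := by
  rw [← xi_one_sub]
  exact xi_ne_zero_of_one_le_re (by simp; linarith)

/-- The quotient `ξ(x + 1) / ξ(x)` without its zeta values. -/
noncomputable def xiRatio (x : ℂ) : ℂ :=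
  (x + 1) / (x - 1) * (Real.pi : ℂ) ^ (-1 / 2 : ℂ) * gammaRatio x

/-- Source of both kinds of factor in the expansion of E_p: the Gamma part becomes hypergeometric in
z, the zeta part a Dirichlet series. -/
theorem xi_add_one {x : ℂ} (hx : 1 < x.re) :
    xi (x + 1) = xi x * (xiRatio x * (riemannZeta (x + 1) / riemannZeta x)) := by
  have h0 : x ≠ 0 := by rintro rfl; norm_num at hx
  have h1 : x ≠ 1 := by rintro rfl; norm_num at hx
  have h1' : x - 1 ≠ 0 := sub_ne_zero.mpr h1
  have hG : Complex.Gamma (x / 2) ≠ 0 := Complex.Gamma_ne_zero_of_re_pos (by simp; linarith)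
  have hz : riemannZeta x ≠ 0 := riemannZeta_ne_zero_of_one_le_re hx.le
  have e : (Real.pi : ℂ) ^ (-(x + 1) / 2) =
      (Real.pi : ℂ) ^ (-x / 2) * (Real.pi : ℂ) ^ (-1 / 2 : ℂ) := by
    rw [← Complex.cpow_add _ _ (by simp [Real.pi_ne_zero])]
    congr 1
    ring
  rw [xi_eq_of_re_pos (x + 1) (by simp; linarith) (by simpa using h0),
    xi_eq_of_re_pos x (by linarith) h1, e, xiRatio, gammaRatio]
  field_simp
  ring

theorem isHypergeometric_xiRatio {k : ℕ} (hk : 0 < k) (c : ℂ) :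
    ∃ a, IsHypergeometric (fun z => xiRatio ((k : ℂ) * z + c)) a := by
  have hk' : (k : ℂ) ≠ 0 := by exact_mod_cast hk.ne'
  have h := (((IsHypergeometric.affine hk' (c + 1)).div (IsHypergeometric.affine hk' (c - 1))).mul
    (IsHypergeometric.const (cpow_ne_zero_of_ne_zero (show (Real.pi : ℂ) ≠ 0 by
      simp [Real.pi_ne_zero]) (-1 / 2 : ℂ)))).mul (isHypergeometric_gammaRatio hk c)
  refine ⟨_, h.congr (Eventually.of_forall fun z => ?_)⟩
  simp only [xiRatio, add_assoc, add_sub_assoc]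

theorem comp_neg_X_ne_zero {q : ℂ[X]} (hq : q ≠ 0) : q.comp (-X) ≠ 0 := by
  intro h
  apply hq
  have := congrArg (fun r : ℂ[X] => r.comp (-X)) h
  simpa [comp_assoc] using this

theorem eventually_eval_neg_ne_zero {q : ℂ[X]} (hq : q ≠ 0) :
    ∀ᶠ z in reTop, q.eval (-z) ≠ 0 := by
  simpa using eventually_eval_ne_zero (comp_neg_X_ne_zero hq)

/-- A sum of simple fractions, some of which coincide and have a pole at `0` that the others do
not have, does not vanish identically. -/
theorem not_eventually_sum_div_eq_zero {κ : Type*} (A B : Finset κ) (hA : A.Nonempty)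
    (c : κ → ℂ) (f : κ → ℂ[X]) {c₀ : ℂ} (hc₀ : c₀ ≠ 0) {g : ℂ[X]} (hg : g ≠ 0)
    (hg0 : g.eval 0 = 0) (hcA : ∀ w ∈ A, c w = c₀) (hfA : ∀ w ∈ A, f w = g)
    (hfB : ∀ w ∈ B, (f w).eval 0 ≠ 0) :
    ¬ ∀ᶠ z in reTop, ∑ w ∈ A, c w / (f w).eval (-z) + ∑ w ∈ B, c w / (f w).eval (-z) = 0 := by
  intro h
  -- Numerator of the sum over the common denominator g ∏ f_v. At 0 the second summand vanishes with
  -- g and the first does not, so q is a nonzero polynomial.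
  set q : ℂ[X] := C (A.card * c₀) * ∏ v ∈ B, f v +
    g * ∑ w ∈ B, C (c w) * ∏ v ∈ B.erase w, f v with hq
  have hq0 : q.eval 0 ≠ 0 := by
    have : q.eval 0 = A.card * c₀ * ∏ v ∈ B, (f v).eval 0 := by
      simp [hq, hg0, eval_prod]
    rw [this]
    refine mul_ne_zero (mul_ne_zero ?_ hc₀) (Finset.prod_ne_zero_iff.mpr hfB)
    exact_mod_cast hA.card_ne_zero
  have hqne : q ≠ 0 := fun h => hq0 (by simp [h])
  have hB : ∀ᶠ z in reTop, ∀ w ∈ B, (f w).eval (-z) ≠ 0 :=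
    (eventually_all_finset B).mpr fun w hw =>
      eventually_eval_neg_ne_zero fun h0 => hfB w hw (by simp [h0])
  obtain ⟨z, hz, hzq, hzg, hzB⟩ := (h.and ((eventually_eval_neg_ne_zero hqne).and
    ((eventually_eval_neg_ne_zero hg).and hB))).exists
  apply hzq
  have e1 : ∑ w ∈ A, c w / (f w).eval (-z) = A.card * (c₀ / g.eval (-z)) := by
    rw [Finset.sum_congr rfl fun w hw => by rw [hcA w hw, hfA w hw]]
    simp
  have e2 : ∀ w ∈ B, c w * ∏ v ∈ B.erase w, (f v).eval (-z) =
      c w / (f w).eval (-z) * ∏ v ∈ B, (f v).eval (-z) := fun w hw => by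
    rw [← Finset.mul_prod_erase B _ hw]
    field_simp [hzB w hw]
  have e3 : q.eval (-z) = g.eval (-z) * (∏ v ∈ B, (f v).eval (-z)) *
      (∑ w ∈ A, c w / (f w).eval (-z) + ∑ w ∈ B, c w / (f w).eval (-z)) := by
    rw [e1]
    simp only [hq, eval_add, eval_mul, eval_C, eval_prod, eval_finsetSum]
    rw [Finset.sum_congr rfl e2, ← Finset.sum_mul]
    field_simp
  rw [e3, hz, mul_zero]

section
variable {ι M N : Type*} [Fintype ι] [AddCommGroup M] [Module ℝ M] [AddCommGroup N] [Module ℝ N]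
  {P : RootPairing ι ℝ M N} [P.IsRootSystem] [P.IsCrystallographic] [P.IsReduced]
  (b : P.Base) (p : b.support)

/-- The level `⟨λ_p, α^∨⟩` of a positive root as a natural number. -/
noncomputable def level (i : ι) : ℕ := ⌊lam b p i⌋₊

/-- The height of a positive coroot as a natural number. -/
noncomputable def height (i : ι) : ℕ := ⌊ht b i⌋₊

variable {b}

theorem lam_eq_level {i : ι} (hi : b.IsPos i) : lam b p i = level b p i := by
  obtain ⟨k, h, hk, -, -⟩ := exists_nat_lam_ht b p hi
  simp [level, hk]

theorem ht_eq_height {i : ι} (hi : b.IsPos i) : ht b i = height b i := by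
  obtain ⟨f, hf⟩ := exists_nat_eq_cocoord b hi
  have : ht b i = (∑ j, f j : ℕ) := by simp [ht_eq_sum_cocoord, hf]
  rw [height, this, Nat.floor_natCast]

theorem one_le_ht (p : b.support) {i : ι} (hi : b.IsPos i) : 1 ≤ ht b i := by
  obtain ⟨k, h, -, hh, h1⟩ := exists_nat_lam_ht b p hi
  rw [hh]
  exact_mod_cast h1

end
end WengZeta

/-! ### The polynomial factors, and the terms without inversions -/

namespace WengZeta
set_option linter.unusedSectionVars false
open Filter Topology Polynomial
open scoped Classical

section
variable {ι M N : Type*} [Fintype ι] [AddCommGroup M] [Module ℝ M] [AddCommGroup N] [Module ℝ N]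
  {P : RootPairing ι ℝ M N} [P.IsRootSystem] [P.IsCrystallographic] [P.IsReduced]
  {b : P.Base} (p : b.support)

theorem delta_nonneg (w : P.weylGroup) (i : ι) : 0 ≤ delta b w i := by
  rw [delta]
  split_ifs <;> norm_num

theorem isPos_of_mem_posOff {i : ι} (hi : i ∈ posOff b p) : b.IsPos i := by
  simp only [posOff, Finset.mem_filter] at hi
  exact hi.2.1

theorem one_le_level {i : ι} (hi : i ∈ posOff b p) : 1 ≤ level b p i := by
  have h := hi
  simp only [posOff, Finset.mem_filter] at h
  have h2 := h.2.2
  rw [lam_eq_level p h.2.1] at h2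
  exact Nat.one_le_iff_ne_zero.mpr (by exact_mod_cast h2)

theorem one_le_height (p : b.support) {i : ι} (hi : b.IsPos i) : 1 ≤ height b i := by
  have := one_le_ht p hi
  rw [ht_eq_height hi] at this
  exact_mod_cast this

theorem lam_self : lam b p p = 1 := by
  simp [lam_eq_cocoord, cocoord_simple]

theorem self_mem_posOff : (p : ι) ∈ posOff b p := by
  simp only [posOff, Finset.mem_filter]
  exact ⟨Finset.mem_univ _, RootPairing.Base.isPos_of_mem_support p.2, by rw [lam_self]; norm_num⟩

theorem eq_of_ht_eq_one {i : ι} (h1 : ht b i = 1) (hi : i ∉ simpleOff b p) : i = p := by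
  by_contra h
  exact hi (Finset.mem_erase.mpr ⟨h, mem_support_of_ht_eq_one b h1⟩)

theorem ht_ne_one_of_lam_eq_zero {i : ι} (h0 : lam b p i = 0) (hi : i ∉ simpleOff b p) :
    ht b i ≠ 1 := by
  intro h1
  rw [eq_of_ht_eq_one p h1 hi, lam_self] at h0
  norm_num at h0

theorem linPoly_ne_zero {i : ι} {c : ℝ} (h : lam b p i = 0 → ht b i + c ≠ 0) :
    linPoly b p i c ≠ 0 := by
  intro h0
  have h1 : lam b p i = 0 := by
    have := congrArg (fun q : ℂ[X] => q.coeff 1) h0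
    simpa [linPoly, coeff_C] using this
  have h2 := congrArg (fun q : ℂ[X] => q.coeff 0) h0
  apply h h1
  have h3 : ((ht b i + c : ℝ) : ℂ) = 0 := by simpa [linPoly] using h2
  exact_mod_cast h3

/-- A linear factor could vanish identically only at level 0 with coroot height 1; outside Δ_p,
height 1 forces the root α_p, whose level is 1. -/
theorem factorPoly_ne_zero (w : P.weylGroup) : factorPoly b p w ≠ 0 := by
  refine mul_ne_zero (mul_ne_zero (pow_ne_zero _ two_ne_zero)
    (Finset.prod_ne_zero_iff.mpr fun i hi => ?_)) (Finset.prod_ne_zero_iff.mpr fun i hi => ?_)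
  · simp only [Finset.mem_filter] at hi
    refine linPoly_ne_zero p fun h0 h1 => ht_ne_one_of_lam_eq_zero p h0 hi.2.2 (by linarith)
  · simp only [Finset.mem_filter] at hi
    have h1 := one_le_ht p hi.2.1
    have h2 := delta_nonneg (b := b) w i
    refine mul_ne_zero (linPoly_ne_zero p fun h0 => by linarith) (linPoly_ne_zero p fun h0 h3 => ?_)
    exact ht_ne_one_of_lam_eq_zero p h0 hi.2.2 (by linarith)

theorem constC_ne_zero (w : P.weylGroup) : constC b p w ≠ 0 := by
  refine mul_ne_zero (pow_ne_zero _ (xi_ne_zero_of_one_le_re (by norm_num)))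
    (Finset.prod_ne_zero_iff.mpr fun i hi => xi_ne_zero_of_one_le_re ?_)
  simp only [posLevi, Finset.mem_sdiff, Finset.mem_filter] at hi
  rw [Complex.ofReal_re]
  linarith [one_le_ht p hi.1.2.1, delta_nonneg (b := b) w i]

variable (b) in
/-- The set `(Φ⁺ \ Φ_p⁺) ∩ w⁻¹Φ⁻`. -/
noncomputable def inversions (w : P.weylGroup) : Finset ι :=
  (posOff b p).filter fun i => ¬ PosAt b w i

theorem mem_posOff_of_mem_inversions {w : P.weylGroup} {i : ι} (hi : i ∈ inversions b p w) :
    i ∈ posOff b p :=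
  (Finset.mem_filter.mp hi).1

theorem posAt_of_inversions_eq_empty {w : P.weylGroup} (hw : inversions b p w = ∅) {i : ι}
    (hi : i ∈ posOff b p) : PosAt b w i := by
  by_contra h
  have : i ∈ inversions b p w := Finset.mem_filter.mpr ⟨hi, h⟩
  simp [hw] at this

theorem posAt_one {i : ι} (hi : b.IsPos i) : PosAt b (1 : P.weylGroup) i := by
  simpa [PosAt] using hi

theorem mem_frakW {w : P.weylGroup} : w ∈ frakW b p ↔ ∀ i ∈ simpleOff b p,
    P.weylGroupToPerm w i ∈ b.support ∨ ¬ PosAt b w i := by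
  simp [frakW]

/-- At s = 0 a linear factor reduces to a height plus a constant, and can vanish only at coroot
height 1, that is, at α_p. The first product contains α_p only if w sends it to a simple root, the
second gives zero there only if w makes it negative; both are excluded. -/
theorem eval_factorPoly_zero_ne_zero {w : P.weylGroup} (hw : inversions b p w = ∅)
    (hp : P.weylGroupToPerm w p ∉ b.support) : (factorPoly b p w).eval 0 ≠ 0 := by
  have hlin : ∀ i c, ht b i + c ≠ 0 → (linPoly b p i c).eval 0 ≠ 0 := fun i c h => by
    simp only [linPoly, eval_add, eval_mul, eval_C, eval_X, mul_zero, zero_add]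
    exact_mod_cast h
  rw [factorPoly]
  simp only [eval_mul, eval_prod, eval_pow, eval_ofNat]
  refine mul_ne_zero (mul_ne_zero (pow_ne_zero _ two_ne_zero)
    (Finset.prod_ne_zero_iff.mpr fun i hi => ?_)) (Finset.prod_ne_zero_iff.mpr fun i hi => ?_)
  · simp only [Finset.mem_filter] at hi
    refine hlin _ _ fun h => hp ?_
    rw [← eq_of_ht_eq_one p (by linarith) hi.2.2]
    exact hi.2.1
  · simp only [Finset.mem_filter] at hi
    have h1 := one_le_ht p hi.2.1
    have h2 := delta_nonneg (b := b) w i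
    refine mul_ne_zero (hlin _ _ (by linarith)) (hlin _ _ fun h3 => ?_)
    have h4 : delta b w i = 0 := by linarith
    have h5 := eq_of_ht_eq_one p (by linarith : ht b i = 1) hi.2.2
    have h6 : PosAt b w i := posAt_of_inversions_eq_empty p hw (h5 ▸ self_mem_posOff p)
    simp [delta, h6] at h4

/-- The factor of α_p in the first product is (s + 1) - 1 = s. It creates the pole that makes the
inversion-free sum nonzero. -/
theorem eval_factorPoly_one_zero : (factorPoly b p 1).eval 0 = 0 := by
  have h : linPoly b p p (-1) ∣ factorPoly b p 1 := by
    rw [factorPoly]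
    refine Dvd.dvd.mul_right (Dvd.dvd.mul_left (Finset.dvd_prod_of_mem _ ?_) _) _
    simp only [Finset.mem_filter]
    exact ⟨Finset.mem_univ _, by simp, by simp [simpleOff]⟩
  obtain ⟨q, hq⟩ := h
  rw [hq, eval_mul]
  simp [linPoly, weylVector_simple_coroot b p.2]

theorem posAt_iff_of_map_simple {w : P.weylGroup}
    (hw : ∀ j ∈ b.support, P.weylGroupToPerm w j ∈ b.support) {i : ι} (hi : b.IsPos i) :
    PosAt b w i ↔ PosAt b (1 : P.weylGroup) i :=
  iff_of_true (posAt_of_map_simple b hw hi) (posAt_one hi)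

theorem delta_of_map_simple {w : P.weylGroup}
    (hw : ∀ j ∈ b.support, P.weylGroupToPerm w j ∈ b.support) {i : ι} (hi : b.IsPos i) :
    delta b w i = delta b 1 i := by
  simp only [delta, posAt_iff_of_map_simple hw hi]

theorem filter_simpleOff_of_map_simple {w : P.weylGroup}
    (hw : ∀ j ∈ b.support, P.weylGroupToPerm w j ∈ b.support) :
    ((simpleOff b p).filter fun i => PosAt b w i) =
      (simpleOff b p).filter fun i => PosAt b (1 : P.weylGroup) i :=
  Finset.filter_congr fun _ hi => posAt_iff_of_map_simple hw
    (RootPairing.Base.isPos_of_mem_support (Finset.mem_of_mem_erase hi))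

theorem factorPoly_of_map_simple {w : P.weylGroup}
    (hw : ∀ j ∈ b.support, P.weylGroupToPerm w j ∈ b.support) :
    factorPoly b p w = factorPoly b p 1 := by
  rw [factorPoly, factorPoly, filter_simpleOff_of_map_simple p hw]
  congr 1
  · congr 1
    refine Finset.prod_congr (Finset.filter_congr fun i _ => ?_) fun _ _ => rfl
    rw [mem_support_iff_of_map_simple b hw, map_one, Equiv.Perm.one_apply]
  · refine Finset.prod_congr rfl fun i hi => ?_
    simp only [Finset.mem_filter] at hi
    rw [delta_of_map_simple hw hi.2.1]

theorem constC_of_map_simple {w : P.weylGroup}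
    (hw : ∀ j ∈ b.support, P.weylGroupToPerm w j ∈ b.support) :
    constC b p w = constC b p 1 := by
  rw [constC, constC, filter_simpleOff_of_map_simple p hw]
  congr 1
  refine Finset.prod_congr rfl fun i hi => ?_
  simp only [posLevi, Finset.mem_sdiff, Finset.mem_filter] at hi
  rw [delta_of_map_simple hw hi.1.2.1]

/-- The positive root whose coroot has full support has nonzero level, so it is not inverted; then
`map_simple_of_isPos` applies. -/
theorem map_simple_of_inversions_eq_empty [P.IsIrreducible] {w : P.weylGroup}
    (hw : w ∈ frakW b p) (hinv : inversions b p w = ∅)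
    (hp : P.weylGroupToPerm w p ∈ b.support) :
    ∀ j ∈ b.support, P.weylGroupToPerm w j ∈ b.support := by
  obtain ⟨i, hi, hfull⟩ := exists_isPos_forall_cocoord_ne_zero b
  refine map_simple_of_isPos b (fun j hj => ?_) hi hfull
    (posAt_of_inversions_eq_empty p hinv ?_)
  · by_cases h : j = p
    · rw [h]; exact Or.inl hp
    · exact (mem_frakW p).mp hw j (Finset.mem_erase.mpr ⟨h, hj⟩)
  · simp only [posOff, Finset.mem_filter]
    exact ⟨Finset.mem_univ _, hi, by rw [lam_eq_cocoord]; exact hfull p⟩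

variable (b) in
theorem inversions_one : inversions b p 1 = ∅ := by
  simp only [inversions, Finset.filter_eq_empty_iff, not_not]
  exact fun i hi => posAt_one (isPos_of_mem_posOff p hi)

/-- The elements sending α_p to a simple root permute the base and all contribute the term of the
identity, so they reinforce its pole at z = 0. The remaining terms are regular there. -/
theorem not_eventually_sum_constC_div_eq_zero [P.IsIrreducible] :
    ¬ ∀ᶠ z in reTop, ∑ w ∈ (frakW b p).filter (fun w => inversions b p w = ∅),
      constC b p w / (factorPoly b p w).eval (-z) = 0 := by
  set W₀ := (frakW b p).filter (fun w => inversions b p w = ∅)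
  have hA : ∀ w ∈ W₀.filter (fun w => P.weylGroupToPerm w p ∈ b.support),
      ∀ j ∈ b.support, P.weylGroupToPerm w j ∈ b.support := fun w hw => by
    simp only [W₀, Finset.mem_filter] at hw
    exact map_simple_of_inversions_eq_empty p hw.1.1 hw.1.2 hw.2
  have := not_eventually_sum_div_eq_zero
    (W₀.filter (fun w => P.weylGroupToPerm w p ∈ b.support))
    (W₀.filter (fun w => P.weylGroupToPerm w p ∉ b.support))
    ⟨1, by simp [W₀, one_mem_frakW, inversions_one]⟩
    (constC b p) (factorPoly b p) (constC_ne_zero p 1) (factorPoly_ne_zero p 1)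
    (eval_factorPoly_one_zero p) (fun w hw => constC_of_map_simple p (hA w hw))
    (fun w hw => factorPoly_of_map_simple p (hA w hw)) (fun w hw => by
      simp only [W₀, Finset.mem_filter] at hw
      exact eval_factorPoly_zero_ne_zero p hw.1.2 hw.2)
  simpa only [Finset.sum_filter_add_sum_filter_not] using this

end
end WengZeta

/-! ### Expansion of E_p(-z) and the zero-free region -/

namespace WengZeta
set_option linter.unusedSectionVars false
open Filter Topology Polynomial
open scoped Classical

section
variable {ι M N : Type*} [Fintype ι] [AddCommGroup M] [Module ℝ M] [AddCommGroup N] [Module ℝ N]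
  {P : RootPairing ι ℝ M N} [P.IsRootSystem] [P.IsCrystallographic] [P.IsReduced]
  (b : P.Base) (p : b.support)

/-- The weight of the summand of `w` in `E_p`. -/
noncomputable def weight (w : P.weylGroup) : ℂ :=
  if 2 * lp b p w < (posOff b p).card then 1
  else if 2 * lp b p w = (posOff b p).card then 1 / 2 else 0

/-- The summand of `w` in `E_p(-z)`, relative to that of the identity, without zeta values. -/
noncomputable def gammaPart (w : P.weylGroup) (z : ℂ) : ℂ :=
  weight b p w * (constC b p w / (factorPoly b p w).eval (-z)) *
    ∏ i ∈ inversions b p w, xiRatio ((level b p i : ℂ) * z + -(height b i : ℂ))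

/-- The coefficients of the quotient of zeta values in the summand of `w` in `E_p(-z)`. -/
noncomputable def zetaPart (w : P.weylGroup) : ArithmeticFunction ℂ :=
  ∏ i ∈ inversions b p w, powLift (level b p i) (zetaQuotient (height b i))

variable {b}

theorem gammaPart_eq_zero_or_isHypergeometric (w : P.weylGroup) :
    (∀ᶠ z in reTop, gammaPart b p w z = 0) ∨ ∃ e, IsHypergeometric (gammaPart b p w) e := by
  by_cases hc : weight b p w = 0
  · exact Or.inl (Eventually.of_forall fun z => by simp [gammaPart, hc])
  · right
    obtain ⟨e₁, h₁⟩ := IsHypergeometric.polynomial (comp_neg_X_ne_zero (factorPoly_ne_zero p w))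
    obtain ⟨e₂, h₂⟩ := IsHypergeometric.prod (inversions b p w)
      (fun i z => xiRatio ((level b p i : ℂ) * z + -(height b i : ℂ)))
      fun i hi => isHypergeometric_xiRatio
        (one_le_level p (mem_posOff_of_mem_inversions p hi)) _
    refine ⟨_, (((IsHypergeometric.const hc).mul
      ((IsHypergeometric.const (constC_ne_zero p w)).div h₁)).mul h₂).congr
      (Eventually.of_forall fun z => ?_)⟩
    simp [gammaPart]

theorem isMultiplicative_zetaPart (w : P.weylGroup) : (zetaPart b p w).IsMultiplicative :=
  isMultiplicative_prod _ _ fun _ hi => isMultiplicative_powLift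
    (Nat.one_le_iff_ne_zero.mp (one_le_level p (mem_posOff_of_mem_inversions p hi)))
    (isMultiplicative_zetaQuotient _)

theorem eventually_LSeriesHasSum_zetaPart (w : P.weylGroup) :
    ∀ᶠ z in reTop, LSeriesHasSum (fun n => zetaPart b p w n) z
      (∏ i ∈ inversions b p w, (riemannZeta ((level b p i : ℂ) * z - height b i + 1) /
        riemannZeta ((level b p i : ℂ) * z - height b i))) := by
  have h : ∀ᶠ z : ℂ in reTop, ∀ i ∈ inversions b p w, (height b i : ℝ) + 2 ≤ z.re :=
    (eventually_all_finset _).mpr fun i _ => eventually_re_ge _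
  filter_upwards [h] with z hz
  refine LSeriesHasSum_prod _ _ _ _ fun i hi => ?_
  have hoff := mem_posOff_of_mem_inversions p hi
  have hk := one_le_level p hoff
  refine LSeriesHasSum_powLift (Nat.one_le_iff_ne_zero.mp hk)
    (LSeriesHasSum_zetaQuotient (one_le_height p (isPos_of_mem_posOff p hoff)) ?_)
  have h1 := hz i hi
  have h2 : (1 : ℝ) ≤ level b p i := by exact_mod_cast hk
  have h3 : ((level b p i : ℂ) * z).re = level b p i * z.re := by simp
  have h4 : (0 : ℝ) ≤ height b i := Nat.cast_nonneg _
  rw [h3]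
  nlinarith

/-- After the functional equation the factors of w and of the identity agree, except at inversions,
where ξ(x) is replaced by ξ(x + 1). -/
theorem eventually_Xpw_neg (w : P.weylGroup) :
    ∀ᶠ z in reTop, Xpw b p 1 (-z) ≠ 0 ∧ Xpw b p w (-z) = Xpw b p 1 (-z) *
      ((∏ i ∈ inversions b p w, xiRatio ((level b p i : ℂ) * z + -(height b i : ℂ))) *
        LSeries (fun n => zetaPart b p w n) z) := by
  have h : ∀ᶠ z : ℂ in reTop, ∀ i ∈ posOff b p, (height b i : ℝ) + 2 ≤ z.re :=
    (eventually_all_finset _).mpr fun i _ => eventually_re_ge _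
  filter_upwards [h, eventually_LSeriesHasSum_zetaPart p w] with z hz hL
  have hre : ∀ i ∈ posOff b p, 1 < ((level b p i : ℂ) * z - height b i).re := fun i hi => by
    have h1 := hz i hi
    have h2 : (1 : ℝ) ≤ level b p i := by exact_mod_cast one_le_level p hi
    have h4 : (0 : ℝ) ≤ height b i := Nat.cast_nonneg _
    simp only [Complex.sub_re, Complex.mul_re, Complex.natCast_re, Complex.natCast_im, zero_mul,
      sub_zero]
    nlinarith
  have harg : ∀ v : P.weylGroup, ∀ i ∈ posOff b p,
      xi ((lam b p i : ℂ) * -z + ((ht b i + delta b v i : ℝ) : ℂ)) =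
        if PosAt b v i then xi ((level b p i : ℂ) * z - height b i)
        else xi ((level b p i : ℂ) * z - height b i + 1) := fun v i hi => by
    have hpos := isPos_of_mem_posOff p hi
    rw [lam_eq_level p hpos, ht_eq_height hpos, ← xi_one_sub, delta]
    split_ifs <;> congr 1 <;> push_cast <;> ring
  have hone : Xpw b p 1 (-z) = ∏ i ∈ posOff b p, xi ((level b p i : ℂ) * z - height b i) :=
    Finset.prod_congr rfl fun i hi => by
      rw [harg 1 i hi, if_pos (posAt_one (isPos_of_mem_posOff p hi))]
  refine ⟨?_, ?_⟩
  · rw [hone]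
    exact Finset.prod_ne_zero_iff.mpr fun i hi => xi_ne_zero_of_one_le_re (hre i hi).le
  · rw [hL.LSeries_eq, ← Finset.prod_mul_distrib, hone, inversions, Finset.prod_filter,
      ← Finset.prod_mul_distrib]
    refine Finset.prod_congr rfl fun i hi => ?_
    rw [harg w i hi, ite_not]
    split_ifs with hw
    · rw [mul_one]
    · rw [xi_add_one (hre i hi), sub_eq_add_neg]

theorem E_eq_sum_weight (s : ℂ) :
    E b p s = ∑ w ∈ frakW b p, weight b p w * ((Qpw b p w).eval s * Xpw b p w s) := by
  rw [E, frakWPos, frakWZero, Finset.sum_filter, Finset.sum_filter, Finset.mul_sum,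
    ← Finset.sum_add_distrib]
  refine Finset.sum_congr rfl fun w _ => ?_
  rw [weight]
  split_ifs with h1 h2
  · omega
  · simp
  · simp
  · simp

theorem eventually_E_neg :
    ∀ᶠ z in reTop, ∃ c : ℂ, c ≠ 0 ∧ E b p (-z) =
      c * ∑ w ∈ frakW b p, gammaPart b p w z * LSeries (fun n => zetaPart b p w n) z := by
  have h1 : ∀ᶠ z in reTop, ∀ w ∈ frakW b p, (factorPoly b p w).eval (-z) ≠ 0 :=
    (eventually_all_finset _).mpr fun w _ => eventually_eval_neg_ne_zero (factorPoly_ne_zero p w)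
  have h2 := (eventually_all_finset (frakW b p)).mpr fun w _ => eventually_Xpw_neg p w
  filter_upwards [h1, h2] with z h1 h2
  -- Dividing out the product of all factors leaves C_{p,w}/f_w for each w, since Q_{p,w} omits
  -- exactly f_w.
  refine ⟨(∏ v ∈ frakW b p, (factorPoly b p v).eval (-z)) * Xpw b p 1 (-z),
    mul_ne_zero (Finset.prod_ne_zero_iff.mpr h1) (h2 1 (one_mem_frakW b p)).1, ?_⟩
  rw [E_eq_sum_weight, Finset.mul_sum]
  refine Finset.sum_congr rfl fun w hw => ?_
  rw [(h2 w hw).2, Qpw, QTilde, gammaPart, ← Finset.mul_prod_erase _ _ hw]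
  simp only [eval_mul, eval_C, eval_prod]
  have := h1 w hw
  field_simp

theorem weight_of_inversions_eq_empty {w : P.weylGroup} (hw : inversions b p w = ∅) :
    weight b p w = 1 := by
  have h0 : lp b p w = 0 := by
    change (inversions b p w).card = 0
    rw [hw, Finset.card_empty]
  have h1 : 0 < (posOff b p).card := Finset.card_pos.mpr ⟨_, self_mem_posOff p⟩
  rw [weight, if_pos (by omega)]

theorem exists_region_E_ne_zero [P.IsIrreducible] :
    ∃ κ x₁ : ℝ, 0 < κ ∧ ∀ z : ℂ, x₁ ≤ z.re → κ * Real.log (|z.im| + 10) ≤ z.re →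
      E b p (-z) ≠ 0 := by
  have hL := (eventually_all_finset (frakW b p)).mpr fun w _ =>
    eventually_LSeriesHasSum_zetaPart p w
  obtain ⟨σ, hσ⟩ := eventually_reTop.mp hL
  obtain ⟨x₀, hx₀⟩ := eventually_reTop.mp (eventually_E_neg p)
  obtain ⟨κ, x₁, hκ, h⟩ := exists_region_sum_ne_zero (frakW b p)
    ((frakW b p).filter fun w => inversions b p w = ∅) (Finset.filter_subset _ _)
    (gammaPart b p) (zetaPart b p) σ (fun w _ => gammaPart_eq_zero_or_isHypergeometric p w)
    (fun w hw => (hσ σ (by simp) w hw).LSeriesSummable)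
    (fun w _ => isMultiplicative_zetaPart p w)
    (fun w hw => by rw [zetaPart, (Finset.mem_filter.mp hw).2, Finset.prod_empty])
    (fun w hw hw' => exists_prod_zetaQuotient_ne_zero _
      (Finset.nonempty_iff_ne_empty.mpr fun h => hw' (Finset.mem_filter.mpr ⟨hw, h⟩)) _ _
      (fun i hi => one_le_level p (mem_posOff_of_mem_inversions p hi))
      (fun i hi => one_le_height p (isPos_of_mem_posOff p (mem_posOff_of_mem_inversions p hi))))
    (fun h0 => not_eventually_sum_constC_div_eq_zero p (h0.mono fun z hz => by
      rw [← hz]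
      refine Finset.sum_congr rfl fun w hw => ?_
      have hw2 := (Finset.mem_filter.mp hw).2
      rw [gammaPart, weight_of_inversions_eq_empty p hw2, hw2, Finset.prod_empty, one_mul,
        mul_one]))
  refine ⟨κ, max x₀ x₁, hκ, fun z hz hz' => ?_⟩
  obtain ⟨c, hc, hE⟩ := hx₀ z (le_of_max_le_left hz)
  rw [hE]
  exact mul_ne_zero hc (h z (le_of_max_le_right hz) hz')

theorem R_ne_zero : R b p ≠ 0 := by
  have h := (dvd_R_iff b p (R b p)).mp dvd_rfl 1 (one_mem_frakW b p)
  refine ne_zero_of_dvd_ne_zero (mul_ne_zero ?_ ?_) h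
  · simpa using constC_ne_zero p 1
  · exact Finset.prod_ne_zero_iff.mpr fun v _ => factorPoly_ne_zero p v

/-- Far to the left every argument ks + h with nonzero exponent has nonpositive real part, where ξ
has no zeros, so the sign of the exponents is irrelevant. Finiteness of the set of such exponents
gives one half-plane for all of them. -/
theorem eventually_D_neg_ne_zero : ∀ᶠ z in reTop, D b p (-z) ≠ 0 := by
  have h : ∀ᶠ z : ℂ in reTop, ∀ x ∈ {x : ℤ × ℤ | expD b p x.1 x.2 ≠ 0},
      max (x.2 : ℝ) 0 ≤ z.re :=
    (eventually_all_finite (finite_expD_ne_zero b p)).mpr fun x _ => eventually_re_ge _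
  filter_upwards [h] with z hz
  rw [D]
  refine finprod_mem_induction (fun a : ℂ => a ≠ 0) one_ne_zero
    (fun _ _ => mul_ne_zero) fun x hx => ?_
  by_cases he : expD b p x.1 x.2 = 0
  · simp [he]
  · refine zpow_ne_zero _ (xi_ne_zero_of_re_nonpos ?_)
    have h1 := hz x he
    have h2 : (1 : ℝ) ≤ x.1 := by exact_mod_cast hx.1
    have h3 := le_of_max_le_left h1
    have h4 := le_of_max_le_right h1
    simp only [mul_neg, Complex.add_re, Complex.neg_re, Complex.mul_re, Complex.intCast_re,
      Complex.intCast_im, zero_mul, sub_zero]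
    nlinarith

end
end WengZeta

/-- For an irreducible reduced (crystallographic) root system with base `b` and a simple root
`α_p`, the functions `E_p` and `ε_p` have no zeros in `Re s ≤ -κ log(|Im s| + 10)`. -/
theorem proposition6p9 {ι M N : Type*} [Fintype ι] [AddCommGroup M] [Module ℝ M]
    [AddCommGroup N] [Module ℝ N] (P : RootPairing ι ℝ M N) [P.IsRootSystem]
    [P.IsCrystallographic] [P.IsReduced] [P.IsIrreducible] (b : P.Base) (p : b.support) :
    ∃ κ : ℝ, 0 < κ ∧ ∀ s : ℂ, s.re ≤ -κ * Real.log (|s.im| + 10) →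
      WengZeta.E b p s ≠ 0 ∧ WengZeta.eps b p s ≠ 0 := by
  obtain ⟨κ, x₁, hκ, hE⟩ := WengZeta.exists_region_E_ne_zero p
  obtain ⟨x₂, hRD⟩ := WengZeta.eventually_reTop.mp
    ((WengZeta.eventually_eval_neg_ne_zero (WengZeta.R_ne_zero p)).and
      (WengZeta.eventually_D_neg_ne_zero p))
  set m := max κ (max x₁ x₂) with hm
  have hκm : κ ≤ m := le_max_left _ _
  have hx₁ : x₁ ≤ m := (le_max_left _ _).trans (le_max_right _ _)
  have hx₂ : x₂ ≤ m := (le_max_right _ _).trans (le_max_right _ _)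
  refine ⟨m, hκ.trans_le hκm, fun s hs => ?_⟩
  -- As 10 > e, the logarithm is at least 1, so the region with constant m lies in Re s ≤ -m and all
  -- half-plane conditions hold automatically.
  have hlog : 1 ≤ Real.log (|s.im| + 10) := by
    rw [Real.le_log_iff_exp_le (by positivity)]
    linarith [Real.exp_one_lt_d9, abs_nonneg s.im]
  have h1 : m ≤ -s.re := by nlinarith
  have h2 : κ * Real.log (|s.im| + 10) ≤ -s.re := by nlinarith
  have hEs : WengZeta.E b p s ≠ 0 := by
    simpa using hE (-s) (by rw [Complex.neg_re]; linarith) (by simpa using h2)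
  have hRDs := hRD (-s) (by rw [Complex.neg_re]; linarith)
  rw [neg_neg] at hRDs
  exact ⟨hEs, div_ne_zero hEs (mul_ne_zero hRDs.1 hRDs.2)⟩
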